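/- **Setting.** For $p\ge 1$ and $h:\{0,1\}^p\to\mathbb{R}_{>0}$ let $$Z(\theta)=\sum_{x\in\{0,1\}^p}h(x)e^{\langle\theta,x\rangle},\qquad p_\theta(x)=\frac{h(x)e^{\langle\theta,x\rangle}}{Z(\theta)},\qquad \tau_*(\theta)=\mathbb{E}_\theta X\in(0,1)^p\qquad(\theta\in\mathbb{R}^p),$$ and let $\mathrm{Cov}_\theta(X)=\mathbb{E}_\theta\{XX^{\mathsf T}\}-\mathbb{E}_\theta\{X\}\mathbb{E}_\theta\{X\}^{\mathsf T}$. Let $\mathcal{H}=(\mathcal{H}_p)_{p\ge1}$, where $\mathcal{H}_p$ is a set of functions $h:\{0,1\}^p\to\mathbb{R}_{>0}$, each of which is presented to algorithms by the number $p$ and a bit string (a code of $h$). The description length of $h\in\mathcal H_p$ is $p$ plus the length of its code. Rational numbers are given as fractions of integers written in binary; algorithms are deterministic, and time is bit complexity. It is understood that $h(0)$ can be computed from the description of $h$: there is an algorithm that, given $h\in\mathcal H_p$ and a rational $\eta>0$, returns a rational $v$ with $e^{-\eta}h(0)\le v\le e^{\eta}h(0)$ in time polynomial in the length of the input and $1/\eta$.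 A *polynomial consistent estimator from sufficient statistics* for $\mathcal H$ is an algorithm that, given $h\in\mathcal H_p$, a rational vector $\tau\in(0,1)^p$ and a rational $\xi>0$, returns a rational vector $\hat\theta(\tau,\xi)$ with $\|\hat\theta(\tau,\xi)-\theta\|_2\le\xi$ for some $\theta\in\mathbb{R}^p$ such that $\tau_*(\theta)=\tau$, in time polynomial in $1/\xi$, $p$, the maximum description length of the $\tau_i$, and the description lengths of $h$ and of $\xi$. **Theorem.** Let $\delta_p\in(0,1/2)$ for $p\ge1$ (for instance, all equal to a constant $\delta$), and let $L$ and $K$ be real polynomials such that for all $p\ge1$ and all $h\in\mathcal H_p$: * (C1) $\tau_{*,i}(0)\in(\delta_p,1-\delta_p)$ for every $i\in\{1,\dots,p\}$; * (C2) $L(p)>0$, and $\mathrm{Cov}_\theta(X)\succeq \frac1{L(p)}I_{p\times p}$ for all $\theta\in\mathbb{R}^p$ with $\tau_*(\theta)\in[\delta_p,1-\delta_p]^p$; * (C3) $\max_{x,y\in\{0,1\}^p}|\log h(x)-\log h(y)|\le K(p)$. If there exists a polynomial consistent estimator from sufficient statistics for $\mathcal H$, then there is an algorithm that, given $h\in\mathcal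 H_p$ with $p\ge1$ and a rational $$\varepsilon>4p\,\delta_p\big(K(p)+\log(4/\delta_p)\big),$$ returns, in time polynomial in the description lengths of $h$ and of $\varepsilon$ and in $1/\varepsilon$, a rational $\widehat Z$ such that $$e^{-\varepsilon}Z(0)\le\widehat Z\le e^{\varepsilon}Z(0).$$ -/

import Mathlib

namespace SuffStat

/-! ### The computational model

A small programming language on trees with integer leaves, with the logarithmic cost criterion:
evaluating a construct on an input `x` costs the bit size of `x`, on top of the cost of its parts.
Running times in this model and on Turing machines agree up to a polynomial. -/

/-- Data: binary trees whose leaves are integers. -/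
inductive Data where
  | num (n : ℤ) : Data
  | pair (a b : Data) : Data

/-- The bit size of a piece of data (integers are written in binary, with a sign). -/
def Data.size : Data → ℕ
  | .num n => Nat.size n.natAbs + 1
  | .pair a b => a.size + b.size + 1

/-- A list, as data: `a₁, …, aₖ` becomes `(a₁, (a₂, … (aₖ, 0)))`. -/
def Data.ofList : List Data → Data
  | [] => .num 0
  | a :: l => .pair a (Data.ofList l)

/-- A bit string, as data. -/
def Data.ofBits (s : List Bool) : Data :=
  Data.ofList (s.map fun b => .num (if b then 1 else 0))

/-- Programs. Each denotes a partial function from data to data. -/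
inductive Prog where
  | id : Prog
  | const (n : ℤ) : Prog
  | fst : Prog
  | snd : Prog
  /-- `0` on a leaf, `1` on a pair -/
  | isPair : Prog
  | add : Prog
  | sub : Prog
  | mul : Prog
  | div : Prog
  /-- run both programs on the input and pair the results -/
  | pair (f g : Prog) : Prog
  /-- run `f`, then run `g` on its result -/
  | seq (f g : Prog) : Prog
  /-- run `f` if the result of the test `c` is positive, and `g` otherwise -/
  | cond (c f g : Prog) : Prog
  /-- while the result of the test `c` on the current data is positive, apply `f` to it -/
  | loop (c f : Prog) : Prog

/-- `Runs c x y t`: the program `c` halts on input `x` with output `y` after exactly `t` units of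
time. -/
inductive Runs : Prog → Data → Data → ℕ → Prop where
  | id (x : Data) : Runs .id x x x.size
  | const (n : ℤ) (x : Data) : Runs (.const n) x (.num n) x.size
  | fst (a b : Data) : Runs .fst (.pair a b) a (Data.pair a b).size
  | snd (a b : Data) : Runs .snd (.pair a b) b (Data.pair a b).size
  | isPair_num (n : ℤ) : Runs .isPair (.num n) (.num 0) (Data.num n).size
  | isPair_pair (a b : Data) : Runs .isPair (.pair a b) (.num 1) (Data.pair a b).size
  | add (m n : ℤ) :
      Runs .add (.pair (.num m) (.num n)) (.num (m + n)) (Data.pair (.num m) (.num n)).size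
  | sub (m n : ℤ) :
      Runs .sub (.pair (.num m) (.num n)) (.num (m - n)) (Data.pair (.num m) (.num n)).size
  | mul (m n : ℤ) :
      Runs .mul (.pair (.num m) (.num n)) (.num (m * n)) (Data.pair (.num m) (.num n)).size
  | div (m n : ℤ) :
      Runs .div (.pair (.num m) (.num n)) (.num (m / n)) (Data.pair (.num m) (.num n)).size
  | pair {f g : Prog} {x y z : Data} {s t : ℕ} :
      Runs f x y s → Runs g x z t → Runs (.pair f g) x (.pair y z) (x.size + s + t)
  | seq {f g : Prog} {x y z : Data} {s t : ℕ} :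
      Runs f x y s → Runs g y z t → Runs (.seq f g) x z (x.size + s + t)
  | cond_pos {c f g : Prog} {x y : Data} {n : ℤ} {s t : ℕ} :
      Runs c x (.num n) s → 0 < n → Runs f x y t → Runs (.cond c f g) x y (x.size + s + t)
  | cond_neg {c f g : Prog} {x y : Data} {n : ℤ} {s t : ℕ} :
      Runs c x (.num n) s → n ≤ 0 → Runs g x y t → Runs (.cond c f g) x y (x.size + s + t)
  | loop_stop {c f : Prog} {x : Data} {n : ℤ} {s : ℕ} :
      Runs c x (.num n) s → n ≤ 0 → Runs (.loop c f) x x (x.size + s)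
  | loop_step {c f : Prog} {x y z : Data} {n : ℤ} {s t u : ℕ} :
      Runs c x (.num n) s → 0 < n → Runs f x y t → Runs (.loop c f) y z u →
        Runs (.loop c f) x z (x.size + s + t + u)

/-- `RunsWithin c x y T`: on input `x`, the program `c` returns `y` in time at most `T`. -/
def RunsWithin (c : Prog) (x y : Data) (T : ℕ) : Prop := ∃ t ≤ T, Runs c x y t

/-- Rational numbers as handled by programs: fractions, not necessarily in lowest terms. -/
structure Frac where
  num : ℤ
  den : ℕ
  den_pos : 0 < den

/-- The value of a fraction. -/
noncomputable def Frac.val (q : Frac) : ℝ := (q.num : ℝ) / (q.den : ℝ)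

/-- A fraction, as data. -/
def Frac.toData (q : Frac) : Data := .pair (.num q.num) (.num q.den)

/-- The description length of a fraction. -/
def Frac.length (q : Frac) : ℕ := q.toData.size

/-- A vector of fractions, as data. -/
def vecToData {p : ℕ} (v : Fin p → Frac) : Data := Data.ofList (List.ofFn fun i => (v i).toData)

/-- The real vector represented by a vector of fractions. -/
noncomputable def vecVal {p : ℕ} (v : Fin p → Frac) : EuclideanSpace ℝ (Fin p) :=
  WithLp.toLp 2 fun i => (v i).val

/-! ### The exponential family -/

/-- The numerical value of a bit. -/
def bit (b : Bool) : ℝ := if b then 1 else 0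

/-- The unnormalized weight `h(x) exp ⟨θ, x⟩`. -/
noncomputable def weight {p : ℕ} (h : (Fin p → Bool) → ℝ) (θ : EuclideanSpace ℝ (Fin p))
    (x : Fin p → Bool) : ℝ :=
  h x * Real.exp (∑ i, θ i * bit (x i))

/-- The partition function `Z(θ)`. -/
noncomputable def partitionFn {p : ℕ} (h : (Fin p → Bool) → ℝ) (θ : EuclideanSpace ℝ (Fin p)) : ℝ :=
  ∑ x, weight h θ x

/-- The expectation of `f(X)` under `p_θ(x) = h(x) exp ⟨θ, x⟩ / Z(θ)`. -/
noncomputable def expect {p : ℕ} (h : (Fin p → Bool) → ℝ) (θ : EuclideanSpace ℝ (Fin p))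
    (f : (Fin p → Bool) → ℝ) : ℝ :=
  ∑ x, weight h θ x / partitionFn h θ * f x

/-- The moment map `τ_*(θ) = E_θ X`. -/
noncomputable def moment {p : ℕ} (h : (Fin p → Bool) → ℝ) (θ : EuclideanSpace ℝ (Fin p)) :
    EuclideanSpace ℝ (Fin p) :=
  WithLp.toLp 2 fun i => expect h θ fun x => bit (x i)

/-- The covariance matrix of `X` under `p_θ`. -/
noncomputable def covariance {p : ℕ} (h : (Fin p → Bool) → ℝ) (θ : EuclideanSpace ℝ (Fin p)) :
    Matrix (Fin p) (Fin p) ℝ :=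
  Matrix.of fun i j =>
    expect h θ (fun x => bit (x i) * bit (x j)) - moment h θ i * moment h θ j

/-! ### Families of weights and algorithms for them -/

/-- A family of sets of positive weights on `{0,1}^p`, each weight being presented to algorithms
by a bit string. -/
structure WeightFamily where
  carrier : (p : ℕ) → Set ((Fin p → Bool) → ℝ)
  pos : ∀ p, ∀ h ∈ carrier p, ∀ x, 0 < h x
  code : (p : ℕ) → carrier p → List Bool

/-- What an algorithm receives about `h ∈ 𝓗_p`: the dimension `p` and the code of `h`. -/
def WeightFamily.toData (𝓗 : WeightFamily) {p : ℕ} (h : 𝓗.carrier p) : Data :=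
  .pair (.num p) (Data.ofBits (𝓗.code p h))

/-- The description length of `h ∈ 𝓗_p`; the dimension counts in unary, so that it is at
least `p`. -/
def WeightFamily.descLength (𝓗 : WeightFamily) {p : ℕ} (h : 𝓗.carrier p) : ℕ :=
  p + (𝓗.code p h).length

/-- The value `h(0)` can be approximated from the description of `h`, within a factor `e^{±η}`,
in time polynomial in the input length and `1/η`. -/
def EvaluableAtZero (𝓗 : WeightFamily) : Prop :=
  ∃ (c : Prog) (P : Polynomial ℕ), ∀ (p : ℕ) (h : 𝓗.carrier p) (η : Frac), 1 ≤ p → 0 < η.val →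
    ∃ v : Frac,
      RunsWithin c (.pair (𝓗.toData h) η.toData) v.toData
        (P.eval (𝓗.descLength h + η.length + ⌈1 / η.val⌉₊)) ∧
      Real.exp (-η.val) * h.1 (fun _ => false) ≤ v.val ∧
      v.val ≤ Real.exp η.val * h.1 (fun _ => false)

/-- There is a polynomial consistent estimator from sufficient statistics: an algorithm that, given
`h`, `τ ∈ (0,1)^p` and `ξ > 0`, returns a vector at Euclidean distance at most `ξ` from some `θ`
with `τ_*(θ) = τ`, in time polynomial in `1/ξ`, `p`, the maximal description length of the `τ_i`,
and the description lengths of `h` and `ξ`. -/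
def HasPolynomialConsistentEstimator (𝓗 : WeightFamily) : Prop :=
  ∃ (c : Prog) (P : Polynomial ℕ), ∀ (p : ℕ) (h : 𝓗.carrier p) (τ : Fin p → Frac) (ξ : Frac),
    1 ≤ p → (∀ i, (τ i).val ∈ Set.Ioo (0 : ℝ) 1) → 0 < ξ.val →
      ∃ θhat : Fin p → Frac,
        RunsWithin c (.pair (𝓗.toData h) (.pair (vecToData τ) ξ.toData)) (vecToData θhat)
          (P.eval (⌈1 / ξ.val⌉₊ + p + (Finset.univ.sup fun i => (τ i).length) +
            𝓗.descLength h + ξ.length)) ∧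
        ∃ θ : EuclideanSpace ℝ (Fin p), moment h.1 θ = vecVal τ ∧ ‖vecVal θhat - θ‖ ≤ ξ.val

/-- Condition C1: the marginals at zero field lie in `(δ_p, 1 - δ_p)`. -/
def ConditionC1 (𝓗 : WeightFamily) (δ : ℕ → ℝ) : Prop :=
  ∀ (p : ℕ), 1 ≤ p → ∀ h ∈ 𝓗.carrier p, ∀ i, moment h 0 i ∈ Set.Ioo (δ p) (1 - δ p)

/-- Condition C2: `Cov_θ(X) ⪰ (1/L(p)) I` for all `θ` with `τ_*(θ) ∈ [δ_p, 1 - δ_p]^p`. -/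
def ConditionC2 (𝓗 : WeightFamily) (δ : ℕ → ℝ) (L : Polynomial ℝ) : Prop :=
  ∀ (p : ℕ), 1 ≤ p → ∀ h ∈ 𝓗.carrier p, 0 < L.eval (p : ℝ) ∧
    ∀ θ : EuclideanSpace ℝ (Fin p), (∀ i, moment h θ i ∈ Set.Icc (δ p) (1 - δ p)) →
      (covariance h θ - (1 / L.eval (p : ℝ)) • (1 : Matrix (Fin p) (Fin p) ℝ)).PosSemidef

/-- Condition C3: the oscillation of `log h` is at most `K(p)`. -/
def ConditionC3 (𝓗 : WeightFamily) (K : Polynomial ℝ) : Prop :=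
  ∀ (p : ℕ), 1 ≤ p → ∀ h ∈ 𝓗.carrier p, ∀ x y,
    |Real.log (h x) - Real.log (h y)| ≤ K.eval (p : ℝ)

end SuffStat

/-! Write `F(τ) = min_θ (log Z(θ) - ⟨θ, τ⟩)`. The minimum is attained where `τ_*(θ) = τ`, so
`dualValue h θ` is `F(τ_*(θ))`; there `-θ` is a supergradient of the concave function `F`, and `max
F = F(τ_*(0)) = log Z(0)`. An estimator from sufficient statistics is thus a first-order oracle for
`F`: it reveals slopes but no values. Values are recovered by integrating slopes from a point where
`F` is known, namely near the corner `τ = 0`, where `F` is close to `log h(0)`.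

Projected gradient ascent on the grid `{1/D, …, (D-1)/D}^p` yields an average iterate whose value is
nearly `log Z(0)` (`log_partitionFn_le_dualValue_average`). A Riemann sum along the segment from
`(1/D, …, 1/D)` to that average gives the increment of `F` (`abs_dualValue_sub_le`), and the value
at the start is controlled by `dualValue_le_of_moment_const` and `le_dualValue_of_moment_const`. On
`[1/D, 1 - 1/D]^p` the slopes are at most `K + log D` (`abs_param_le`, by flipping one bit), so
parameters of polynomial size make all errors small, for every `ε > 0`. The exponential of the
result is taken as a high power of a rational number.

For the running time, `Computes` expresses that one program serves a whole family of inputs with one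
polynomial bound. Its closure properties, above all the bounded loop `Computes.iterate`, assemble
the algorithm without writing programs out. -/

namespace SuffStat

/-! ### Polynomial bounds -/

/-- `f` is bounded by a polynomial in the measure `m`. -/
def PolyBounded {ι : Type} (m f : ι → ℕ) : Prop :=
  ∃ P : Polynomial ℕ, ∀ i, f i ≤ P.eval (m i)

theorem polynomial_eval_mono (P : Polynomial ℕ) : Monotone fun n : ℕ => P.eval n := by
  intro a b hab
  simp only [Polynomial.eval_eq_sum_range]
  gcongr

namespace PolyBounded

variable {ι κ : Type} {m f g : ι → ℕ}

theorem mono (hg : PolyBounded m g) (h : ∀ i, f i ≤ g i) : PolyBounded m f := by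
  obtain ⟨P, hP⟩ := hg
  exact ⟨P, fun i => (h i).trans (hP i)⟩

theorem self (m : ι → ℕ) : PolyBounded m m := ⟨Polynomial.X, fun i => by simp⟩

theorem const (m : ι → ℕ) (k : ℕ) : PolyBounded m fun _ => k :=
  ⟨Polynomial.C k, fun i => by simp⟩

theorem add (hf : PolyBounded m f) (hg : PolyBounded m g) :
    PolyBounded m fun i => f i + g i := by
  obtain ⟨P, hP⟩ := hf
  obtain ⟨R, hR⟩ := hg
  exact ⟨P + R, fun i => by simpa using add_le_add (hP i) (hR i)⟩

theorem mul (hf : PolyBounded m f) (hg : PolyBounded m g) :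
    PolyBounded m fun i => f i * g i := by
  obtain ⟨P, hP⟩ := hf
  obtain ⟨R, hR⟩ := hg
  exact ⟨P * R, fun i => by simpa using Nat.mul_le_mul (hP i) (hR i)⟩

theorem pow (hf : PolyBounded m f) (k : ℕ) : PolyBounded m fun i => f i ^ k := by
  obtain ⟨P, hP⟩ := hf
  exact ⟨P ^ k, fun i => by simpa using Nat.pow_le_pow_left (hP i) k⟩

theorem eval (P : Polynomial ℕ) (hf : PolyBounded m f) :
    PolyBounded m fun i => P.eval (f i) := by
  obtain ⟨R, hR⟩ := hf
  exact ⟨P.comp R, fun i => by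
    simpa [Polynomial.eval_comp] using polynomial_eval_mono P (hR i)⟩

theorem reindex (hf : PolyBounded m f) (r : κ → ι) : PolyBounded (m ∘ r) (f ∘ r) := by
  obtain ⟨P, hP⟩ := hf
  exact ⟨P, fun i => hP (r i)⟩

end PolyBounded

/-! ### Sizes of data -/

theorem Data.one_le_size (x : Data) : 1 ≤ x.size := by
  cases x <;> simp [Data.size]

theorem natSize_le_of_le_two_pow {n k : ℕ} (h : n ≤ 2 ^ k) : Nat.size n ≤ k + 1 :=
  Nat.size_le.2 (lt_of_le_of_lt h (Nat.pow_lt_pow_right (by norm_num) (Nat.lt_succ_self k)))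

theorem natSize_le_self (n : ℕ) : Nat.size n ≤ n := Nat.size_le.2 Nat.lt_two_pow_self

theorem natSize_add_le (a b : ℕ) : Nat.size (a + b) ≤ Nat.size a + Nat.size b + 1 := by
  apply Nat.size_le.2
  have ha := Nat.lt_size_self a
  have hb := Nat.lt_size_self b
  have h1 : 2 ^ Nat.size a ≤ 2 ^ (Nat.size a + Nat.size b) :=
    Nat.pow_le_pow_right (by norm_num) (by omega)
  have h2 : 2 ^ Nat.size b ≤ 2 ^ (Nat.size a + Nat.size b) :=
    Nat.pow_le_pow_right (by norm_num) (by omega)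
  rw [pow_succ]
  omega

theorem natSize_mul_le (a b : ℕ) : Nat.size (a * b) ≤ Nat.size a + Nat.size b := by
  rcases Nat.eq_zero_or_pos (a * b) with h | h
  · simp [h]
  · apply Nat.size_le.2
    rw [pow_add]
    exact Nat.mul_lt_mul'' (Nat.lt_size_self a) (Nat.lt_size_self b)

theorem natSize_natAbs_ediv_le (a b : ℤ) : Nat.size (a / b).natAbs ≤ Nat.size a.natAbs :=
  Nat.size_le_size (Int.natAbs_ediv_le_natAbs a b)

theorem natSize_natAbs_add_le (a b : ℤ) :
    Nat.size (a + b).natAbs ≤ Nat.size a.natAbs + Nat.size b.natAbs + 1 :=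
  (Nat.size_le_size (Int.natAbs_add_le a b)).trans (natSize_add_le _ _)

theorem natSize_natAbs_sub_le (a b : ℤ) :
    Nat.size (a - b).natAbs ≤ Nat.size a.natAbs + Nat.size b.natAbs + 1 :=
  (Nat.size_le_size (Int.natAbs_sub_le a b)).trans (natSize_add_le _ _)

theorem Runs.size_input_le {c : Prog} {x y : Data} {t : ℕ} (h : Runs c x y t) : x.size ≤ t := by
  cases h <;> omega

/-- Every construct is charged the size of its input, and arithmetic at most adds the sizes of its
operands. The factor depends on `c` because constants and pairing can enlarge the data. Hence a time
bound for one program bounds the input size of the next. -/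
theorem Runs.exists_size_output_le (c : Prog) :
    ∃ k : ℕ, 1 ≤ k ∧ ∀ x y t, Runs c x y t → y.size ≤ k * t := by
  induction c with
  | id => exact ⟨1, le_rfl, fun x y t h => by cases h; omega⟩
  | const n =>
    refine ⟨(Data.num n).size, Data.one_le_size _, fun x y t h => ?_⟩
    cases h
    exact Nat.le_mul_of_pos_right _ (Data.one_le_size x)
  | fst => exact ⟨1, le_rfl, fun x y t h => by cases h; simp [Data.size]; omega⟩
  | snd => exact ⟨1, le_rfl, fun x y t h => by cases h; simp [Data.size]; omega⟩
  | isPair =>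
    refine ⟨2, by norm_num, fun x y t h => ?_⟩
    cases h
    · simp [Data.size]; omega
    · simp [Data.size]
  | add =>
    refine ⟨1, le_rfl, fun x y t h => ?_⟩
    cases h with
    | add a b => have := natSize_natAbs_add_le a b; simp only [Data.size]; omega
  | sub =>
    refine ⟨1, le_rfl, fun x y t h => ?_⟩
    cases h with
    | sub a b => have := natSize_natAbs_sub_le a b; simp only [Data.size]; omega
  | mul =>
    refine ⟨1, le_rfl, fun x y t h => ?_⟩
    cases h with
    | mul a b =>
      have := natSize_mul_le a.natAbs b.natAbs
      simp only [Data.size, Int.natAbs_mul]; omega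
  | div =>
    refine ⟨1, le_rfl, fun x y t h => ?_⟩
    cases h with
    | div a b => have := natSize_natAbs_ediv_le a b; simp only [Data.size]; omega
  | pair f g hf hg =>
    obtain ⟨k, hk, hf⟩ := hf
    obtain ⟨l, hl, hg⟩ := hg
    refine ⟨k + l, by omega, fun x y t h => ?_⟩
    cases h with
    | pair h1 h2 =>
      have := hf _ _ _ h1
      have := hg _ _ _ h2
      have := x.one_le_size
      simp only [Data.size]
      nlinarith
  | seq f g hf hg =>
    obtain ⟨l, hl, hg⟩ := hg
    refine ⟨l, by omega, fun x y t h => ?_⟩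
    cases h with
    | seq h1 h2 => exact (hg _ _ _ h2).trans (Nat.mul_le_mul_left _ (by omega))
  | cond c f g hc hf hg =>
    obtain ⟨k, hk, hf⟩ := hf
    obtain ⟨l, hl, hg⟩ := hg
    refine ⟨k + l, by omega, fun x y t h => ?_⟩
    cases h with
    | cond_pos h1 h2 h3 => exact (hf _ _ _ h3).trans (Nat.mul_le_mul (by omega) (by omega))
    | cond_neg h1 h2 h3 => exact (hg _ _ _ h3).trans (Nat.mul_le_mul (by omega) (by omega))
  | loop c f hc hf =>
    -- The final state is charged in full when the loop stops, so the factor is 1 whatever the body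
    -- does.
    refine ⟨1, le_rfl, fun x y t h => ?_⟩
    generalize hL : Prog.loop c f = L at h
    clear hc hf
    induction h with
    | loop_stop => omega
    | loop_step h1 h2 h3 h4 ih1 ih2 ih3 =>
      have := ih3 hL
      omega
    | _ => exact absurd hL (by simp)

/-- The test returns the number of rounds left, so the loop stops exactly at `X N`. The induction
goes backwards from the end because `Runs.loop_step` extends a run at its front. -/
theorem Runs.loop_iterate {c f : Prog} {X : ℕ → Data} {N z s t : ℕ}
    (hz : ∀ k ≤ N, (X k).size ≤ z)
    (htest : ∀ k ≤ N, RunsWithin c (X k) (.num ((N : ℤ) - k)) s)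
    (hbody : ∀ k < N, RunsWithin f (X k) (X (k + 1)) t) :
    RunsWithin (.loop c f) (X 0) (X N) ((N + 1) * (z + s + t)) := by
  have key : ∀ j ≤ N, RunsWithin (.loop c f) (X (N - j)) (X N) ((j + 1) * (z + s + t)) := by
    intro j
    induction j with
    | zero =>
      intro _
      obtain ⟨u, hu, h⟩ := htest N le_rfl
      refine ⟨_, ?_, Runs.loop_stop h (by simp)⟩
      have := hz N le_rfl
      simp only [Nat.sub_zero]
      omega
    | succ j ih =>
      intro hj
      obtain ⟨u, hu, h⟩ := htest (N - (j + 1)) (by omega)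
      obtain ⟨v, hv, h'⟩ := hbody (N - (j + 1)) (by omega)
      obtain ⟨w, hw, h''⟩ := ih (by omega)
      rw [show N - (j + 1) + 1 = N - j by omega] at h'
      refine ⟨_, ?_, Runs.loop_step h (by omega) h' h''⟩
      have := hz (N - (j + 1)) (by omega)
      rw [add_mul (j + 1) 1]
      omega
  simpa using key N le_rfl

/-! ### Uniform polynomial-time computability over an index family -/

/-- One program turns `a i` into `b i` in time polynomial in `m i`, for all indices `i`. -/
def Computes {ι : Type} (m : ι → ℕ) (a b : ι → Data) : Prop :=
  ∃ (c : Prog) (T : ι → ℕ), PolyBounded m T ∧ ∀ i, RunsWithin c (a i) (b i) (T i)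

/-- Pairs of an index `i` and a natural number below `N i`. -/
abbrev Below {ι : Type} (N : ι → ℕ) : Type := {x : ι × ℕ // x.2 < N x.1}

namespace Below

variable {ι : Type} {N : ι → ℕ}

/-- The index of a pair. -/
def idx (x : Below N) : ι := x.1.1

/-- The number of a pair. -/
def pos (x : Below N) : ℕ := x.1.2

theorem pos_lt (x : Below N) : x.pos < N x.idx := x.2

end Below

theorem PolyBounded.pos {ι : Type} {m N : ι → ℕ} (hN : PolyBounded m N) :
    PolyBounded (m ∘ Below.idx (N := N)) Below.pos :=
  (hN.reindex Below.idx).mono fun x => x.pos_lt.le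

namespace Computes

variable {ι κ : Type} {m : ι → ℕ} {a b d : ι → Data} {x y : ι → ℤ}

theorem congr (h : Computes m a b) {b' : ι → Data} (hb : ∀ i, b i = b' i) : Computes m a b' := by
  rwa [← funext hb]

theorem size_input (h : Computes m a b) : PolyBounded m fun i => (a i).size := by
  obtain ⟨c, T, hT, h⟩ := h
  refine hT.mono fun i => ?_
  obtain ⟨t, ht, hr⟩ := h i
  exact hr.size_input_le.trans ht

theorem size_output (h : Computes m a b) : PolyBounded m fun i => (b i).size := by
  obtain ⟨c, T, hT, h⟩ := h
  obtain ⟨k, -, hk⟩ := Runs.exists_size_output_le c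
  refine ((PolyBounded.const m k).mul hT).mono fun i => ?_
  obtain ⟨t, ht, hr⟩ := h i
  exact (hk _ _ _ hr).trans (Nat.mul_le_mul_left _ ht)

theorem reindex (h : Computes m a b) (r : κ → ι) : Computes (m ∘ r) (a ∘ r) (b ∘ r) := by
  obtain ⟨c, T, hT, h⟩ := h
  exact ⟨c, T ∘ r, hT.reindex r, fun i => h (r i)⟩

theorem refl (h : PolyBounded m fun i => (a i).size) : Computes m a a :=
  ⟨.id, _, h, fun _ => ⟨_, le_rfl, .id _⟩⟩

theorem self (h : Computes m a b) : Computes m a a := refl h.size_input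

theorem const (h : PolyBounded m fun i => (a i).size) (n : ℤ) :
    Computes m a fun _ => .num n :=
  ⟨.const n, _, h, fun _ => ⟨_, le_rfl, .const n _⟩⟩

theorem trans (h : Computes m a b) (h' : Computes m b d) : Computes m a d := by
  have hs := h.size_input
  obtain ⟨c, T, hT, h⟩ := h
  obtain ⟨c', T', hT', h'⟩ := h'
  refine ⟨.seq c c', _, (hs.add hT).add hT', fun i => ?_⟩
  obtain ⟨t, ht, hr⟩ := h i
  obtain ⟨t', ht', hr'⟩ := h' i
  exact ⟨_, by omega, .seq hr hr'⟩

theorem pair (h : Computes m a b) (h' : Computes m a d) :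
    Computes m a fun i => .pair (b i) (d i) := by
  have hs := h.size_input
  obtain ⟨c, T, hT, h⟩ := h
  obtain ⟨c', T', hT', h'⟩ := h'
  refine ⟨.pair c c', _, (hs.add hT).add hT', fun i => ?_⟩
  obtain ⟨t, ht, hr⟩ := h i
  obtain ⟨t', ht', hr'⟩ := h' i
  exact ⟨_, by omega, .pair hr hr'⟩

theorem fst (h : Computes m a fun i => .pair (b i) (d i)) : Computes m a b :=
  h.trans ⟨.fst, _, h.size_output, fun _ => ⟨_, le_rfl, .fst _ _⟩⟩

theorem snd (h : Computes m a fun i => .pair (b i) (d i)) : Computes m a d :=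
  h.trans ⟨.snd, _, h.size_output, fun _ => ⟨_, le_rfl, .snd _ _⟩⟩

theorem add (h : Computes m a fun i => .num (x i)) (h' : Computes m a fun i => .num (y i)) :
    Computes m a fun i => .num (x i + y i) :=
  (h.pair h').trans ⟨.add, _, (h.pair h').size_output, fun _ => ⟨_, le_rfl, .add _ _⟩⟩

theorem sub (h : Computes m a fun i => .num (x i)) (h' : Computes m a fun i => .num (y i)) :
    Computes m a fun i => .num (x i - y i) :=
  (h.pair h').trans ⟨.sub, _, (h.pair h').size_output, fun _ => ⟨_, le_rfl, .sub _ _⟩⟩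

theorem mul (h : Computes m a fun i => .num (x i)) (h' : Computes m a fun i => .num (y i)) :
    Computes m a fun i => .num (x i * y i) :=
  (h.pair h').trans ⟨.mul, _, (h.pair h').size_output, fun _ => ⟨_, le_rfl, .mul _ _⟩⟩

theorem div (h : Computes m a fun i => .num (x i)) (h' : Computes m a fun i => .num (y i)) :
    Computes m a fun i => .num (x i / y i) :=
  (h.pair h').trans ⟨.div, _, (h.pair h').size_output, fun _ => ⟨_, le_rfl, .div _ _⟩⟩

theorem powConst (h : Computes m a fun i => .num (x i)) (k : ℕ) :
    Computes m a fun i => .num (x i ^ k) := by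
  induction k with
  | zero => simpa using const h.size_input 1
  | succ k ih => simpa only [pow_succ] using ih.mul h

theorem ite (hx : Computes m a fun i => .num (x i)) (h : Computes m a b) (h' : Computes m a d) :
    Computes m a fun i => if 0 < x i then b i else d i := by
  have hs := h.size_input
  obtain ⟨c₀, T₀, hT₀, hx⟩ := hx
  obtain ⟨c, T, hT, h⟩ := h
  obtain ⟨c', T', hT', h'⟩ := h'
  refine ⟨.cond c₀ c c', _, ((hs.add hT₀).add hT).add hT', fun i => ?_⟩
  obtain ⟨t₀, ht₀, hr₀⟩ := hx i
  obtain ⟨t, ht, hr⟩ := h i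
  obtain ⟨t', ht', hr'⟩ := h' i
  dsimp only
  split_ifs with hi
  · exact ⟨_, by omega, .cond_pos hr₀ hi hr⟩
  · exact ⟨_, by omega, .cond_neg hr₀ (not_lt.1 hi) hr'⟩

theorem min (h : Computes m a fun i => .num (x i)) (h' : Computes m a fun i => .num (y i)) :
    Computes m a fun i => .num (Min.min (x i) (y i)) :=
  ((h'.sub h).ite h h').congr fun i => by
    split_ifs with hi
    · rw [min_eq_left (by omega)]
    · rw [min_eq_right (by omega)]

theorem max (h : Computes m a fun i => .num (x i)) (h' : Computes m a fun i => .num (y i)) :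
    Computes m a fun i => .num (Max.max (x i) (y i)) :=
  ((h.sub h').ite h h').congr fun i => by
    split_ifs with hi
    · rw [max_eq_left (by omega)]
    · rw [max_eq_right (by omega)]

theorem polyBounded_size_num {n : ι → ℕ} (hn : PolyBounded m n) :
    PolyBounded m fun i => (Data.num (n i)).size :=
  (hn.add (.const m 1)).mono fun i => by simpa [Data.size] using natSize_le_self (n i)

theorem polyBounded_size_pair (ha : PolyBounded m fun i => (a i).size)
    (hb : PolyBounded m fun i => (b i).size) :
    PolyBounded m fun i => (Data.pair (a i) (b i)).size :=
  (ha.add hb).add (.const m 1)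

variable {N : ι → ℕ} {st : ι → ℕ → Data}

/-- A bounded loop that carries the counter and a state. -/
theorem iterate (hN : PolyBounded m N) (hNc : Computes m a fun i => .num (N i))
    (h0 : Computes m a fun i => st i 0)
    (hstep : Computes (m ∘ Below.idx (N := N))
      (fun x => .pair (a x.idx) (.pair (.num x.pos) (st x.idx x.pos)))
      (fun x => st x.idx (x.pos + 1))) :
    Computes m a fun i => st i (N i) := by
  -- The step is polynomial in `m` of the index, uniformly over the rounds, and not merely in the
  -- current state. Each state is the output of such a step, so sizes cannot compound from round to
  -- round.
  obtain ⟨S₀, hS₀⟩ := h0.size_output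
  obtain ⟨S₁, hS₁⟩ := hstep.size_output
  obtain ⟨A, hA⟩ := h0.size_input
  have hst : ∀ i, ∀ k ≤ N i, (st i k).size ≤ (S₀ + S₁).eval (m i) := by
    intro i k hk
    rw [Polynomial.eval_add]
    cases k with
    | zero => exact (hS₀ i).trans (by omega)
    | succ k => exact (hS₁ ⟨(i, k), hk⟩).trans (by simp [Below.idx])
  -- The number of rounds left comes first, so that the loop test is just `fst`.
  let X : ι → ℕ → Data := fun i k =>
    .pair (.num ((N i : ℤ) - k)) (.pair (a i) (.pair (.num k) (st i k)))
  have hinit : Computes m a (fun i => X i 0) := by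
    have := hNc.pair (h0.self.pair ((const h0.size_input 0).pair h0))
    exact this.congr fun i => by simp [X]
  have hXsize : ∀ i, ∀ k ≤ N i,
      (X i k).size ≤ 2 * N i + A.eval (m i) + (S₀ + S₁).eval (m i) + 5 := by
    intro i k hk
    have h1 := hst i k hk
    have h2 : (a i).size ≤ A.eval (m i) := hA i
    have h3 := natSize_le_self ((N i : ℤ) - k).natAbs
    have h4 := natSize_le_self k
    simp only [X, Data.size, Int.natAbs_natCast]
    omega
  have hzP : PolyBounded m fun i => 2 * N i + A.eval (m i) + (S₀ + S₁).eval (m i) + 5 :=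
    ((((PolyBounded.const m 2).mul hN).add ⟨A, fun _ => le_rfl⟩).add
      ⟨S₀ + S₁, fun _ => le_rfl⟩).add (.const m 5)
  have hbody : Computes (m ∘ Below.idx (N := N)) (fun x => X x.idx x.pos)
      (fun x => X x.idx (x.pos + 1)) := by
    have hX : Computes (m ∘ Below.idx (N := N)) (fun x => X x.idx x.pos)
        (fun x => X x.idx x.pos) :=
      refl ((hzP.reindex (Below.idx (N := N))).mono fun x => hXsize _ _ x.pos_lt.le)
    have one := const hX.size_input 1
    have h := (hX.fst.sub one).pair (hX.snd.fst.pair ((hX.snd.snd.fst.add one).pair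
      (hX.snd.trans hstep)))
    exact h.congr fun x => by simp [X, sub_sub]
  obtain ⟨cb, Tb, ⟨Pb, hPb⟩, hb⟩ := hbody
  refine hinit.trans (Computes.snd (b := fun _ => .num 0) (d := fun i => .pair (a i)
    (.pair (.num (N i)) (st i (N i)))) ?_).snd.snd
  refine ⟨.loop .fst cb, _, (hN.add (.const m 1)).mul ((hzP.add hzP).add ⟨Pb, fun _ => le_rfl⟩),
    fun i => ?_⟩
  have hb' : ∀ k < N i, RunsWithin cb (X i k) (X i (k + 1)) (Pb.eval (m i)) := fun k hk => by
    obtain ⟨t, ht, hr⟩ := hb ⟨(i, k), hk⟩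
    exact ⟨t, ht.trans (hPb ⟨(i, k), hk⟩), hr⟩
  have := Runs.loop_iterate (c := .fst) (f := cb) (X := X i) (hXsize i)
    (fun k hk => ⟨_, hXsize i k hk, .fst _ _⟩) hb'
  simpa [X] using this

end Computes

/-! ### Arrays -/

/-- The data list `x 0, …, x (n - 1)`. -/
def arr (x : ℕ → Data) : ℕ → Data
  | 0 => .num 0
  | n + 1 => .pair (x 0) (arr (fun k => x (k + 1)) n)

theorem arr_congr {x y : ℕ → Data} {n : ℕ} (h : ∀ k < n, x k = y k) : arr x n = arr y n := by
  induction n generalizing x y with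
  | zero => rfl
  | succ n ih =>
    simp only [arr]
    rw [h 0 (by omega), ih fun k hk => h (k + 1) (by omega)]

theorem arr_ofFn {p : ℕ} (v : Fin p → Data) :
    Data.ofList (List.ofFn v) = arr (fun k => if hk : k < p then v ⟨k, hk⟩ else .num 0) p := by
  induction p with
  | zero => simp [arr, Data.ofList]
  | succ p ih =>
    rw [List.ofFn_succ, Data.ofList, ih]
    simp only [arr]
    congr 1
    exact arr_congr fun k hk => by simp [hk]

theorem size_arr_le {x : ℕ → Data} {n s : ℕ} (h : ∀ k < n, (x k).size ≤ s) :
    (arr x n).size ≤ n * (s + 1) + 1 := by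
  induction n generalizing x with
  | zero => simp [arr, Data.size]
  | succ n ih =>
    simp only [arr, Data.size]
    have h0 := h 0 (by omega)
    have h1 := ih (x := fun k => x (k + 1)) fun k hk => h (k + 1) (by omega)
    rw [add_mul]
    omega

theorem arr_tail (x : ℕ → Data) (n k : ℕ) (hk : k < n) :
    arr (fun l => x (k + l)) (n - k) =
      .pair (x k) (arr (fun l => x (k + 1 + l)) (n - (k + 1))) := by
  obtain ⟨j, rfl⟩ : ∃ j, n = k + 1 + j := ⟨n - (k + 1), by omega⟩
  rw [show k + 1 + j - k = j + 1 by omega, show k + 1 + j - (k + 1) = j by omega]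
  simp only [arr, add_zero]
  congr 1
  exact arr_congr fun l _ => by congr 1; omega

theorem arr_snoc_front (x : ℕ → Data) (n j : ℕ) (hj : j < n) :
    arr (fun l => x (n - (j + 1) + l)) (j + 1) =
      .pair (x (n - 1 - j)) (arr (fun l => x (n - j + l)) j) := by
  simp only [arr, add_zero]
  rw [show n - (j + 1) = n - 1 - j by omega]
  congr 1
  exact arr_congr fun l _ => by congr 1; omega

theorem natSize_natAbs_sum_le {f : ℕ → ℤ} {n s : ℕ}
    (h : ∀ k < n, Nat.size (f k).natAbs ≤ s) :
    Nat.size (∑ k ∈ Finset.range n, f k).natAbs ≤ n + s + 1 := by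
  apply natSize_le_of_le_two_pow
  calc (∑ k ∈ Finset.range n, f k).natAbs ≤ ∑ k ∈ Finset.range n, (f k).natAbs :=
        Int.natAbs_sum_le _ _
    _ ≤ ∑ k ∈ Finset.range n, 2 ^ s := Finset.sum_le_sum fun k hk =>
        (Nat.size_le.1 (h k (Finset.mem_range.1 hk))).le
    _ = n * 2 ^ s := by simp
    _ ≤ 2 ^ n * 2 ^ s := Nat.mul_le_mul_right _ Nat.lt_two_pow_self.le
    _ = 2 ^ (n + s) := (pow_add _ _ _).symm

namespace Computes

variable {ι : Type} {m : ι → ℕ} {a b : ι → Data} {N : ι → ℕ} {x y : ι → ℕ → Data}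

/-- What is computable from `a` is computable from `a` together with a counter. -/
theorem underCounter (h : Computes m a b) (hN : PolyBounded m N) :
    Computes (m ∘ Below.idx (N := N)) (fun z => .pair (a z.idx) (.num z.pos))
      (fun z => b z.idx) :=
  (fst (refl (polyBounded_size_pair (h.size_input.reindex _) (polyBounded_size_num hN.pos)))).trans
    (h.reindex Below.idx)

theorem counter (ha : PolyBounded m fun i => (a i).size) (hN : PolyBounded m N) :
    Computes (m ∘ Below.idx (N := N)) (fun z => .pair (a z.idx) (.num z.pos))
      (fun z => .num z.pos) :=
  snd (refl (polyBounded_size_pair (ha.reindex _) (polyBounded_size_num hN.pos)))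

/-- Arrays are linked lists: an entry is reached by taking `k i` tails and then one head. -/
theorem get {k : ι → ℕ} (hk : ∀ i, k i < N i) (hN : PolyBounded m N)
    (hx : Computes m a fun i => arr (x i) (N i)) (hkc : Computes m a fun i => .num (k i)) :
    Computes m a fun i => x i (k i) := by
  have hkP : PolyBounded m k := hN.mono fun i => (hk i).le
  obtain ⟨P, hP⟩ := hx.size_output
  have hsz : ∀ i, ∀ j ≤ N i, (arr (fun l => x i (j + l)) (N i - j)).size ≤ P.eval (m i) := by
    intro i j
    induction j with
    | zero => intro _; simpa using hP i
    | succ j ih =>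
      intro hj
      refine le_trans ?_ (ih (by omega))
      rw [arr_tail (x i) (N i) j hj]
      simp only [Data.size]
      omega
  have hz : PolyBounded m fun i => P.eval (m i) := ⟨P, fun _ => le_rfl⟩
  have key : Computes m a fun i => arr (fun l => x i (k i + l)) (N i - k i) := by
    refine iterate (st := fun i j => arr (fun l => x i (j + l)) (N i - j)) hkP hkc
      (by simpa using hx) ?_
    have hs := snd (snd (refl (polyBounded_size_pair (hx.size_input.reindex _)
      (polyBounded_size_pair (polyBounded_size_num hkP.pos)
        ((hz.reindex (Below.idx (N := k))).mono fun z =>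
          hsz z.idx z.pos (z.pos_lt.trans (hk _)).le)))))
    exact snd (hs.congr fun z => arr_tail (x z.idx) (N z.idx) z.pos (z.pos_lt.trans (hk _)))
  exact fst (key.congr fun i => arr_tail (x i) (N i) (k i) (hk i))

/-- Lists grow only at the front, so the entries are produced from the last to the first: after `j`
rounds the state holds the last `j` of them. The map `r` below reverses the counter accordingly. -/
theorem tabulate (hN : PolyBounded m N) (hNc : Computes m a fun i => .num (N i))
    (hx : Computes (m ∘ Below.idx (N := N)) (fun z => .pair (a z.idx) (.num z.pos))
      (fun z => x z.idx z.pos)) :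
    Computes m a fun i => arr (x i) (N i) := by
  obtain ⟨P, hP⟩ := hx.size_output
  have key : Computes m a fun i => arr (fun l => x i (N i - N i + l)) (N i) := by
    refine iterate (st := fun i j => arr (fun l => x i (N i - j + l)) j) hN hNc
      (by simpa [arr] using const hNc.size_input 0) ?_
    have hsz : PolyBounded (m ∘ Below.idx (N := N))
        fun z => (arr (fun l => x z.idx (N z.idx - z.pos + l)) z.pos).size := by
      refine ((hN.mul (PolyBounded.add ⟨P, fun _ => le_rfl⟩ (.const m 1))).add
        (.const m 1)).reindex (Below.idx (N := N)) |>.mono fun z => ?_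
      have hz := z.pos_lt
      refine (size_arr_le (s := P.eval (m z.idx)) fun l hl => ?_).trans ?_
      · exact hP ⟨(z.idx, N z.idx - z.pos + l), by
          change N z.idx - z.pos + l < N z.idx
          omega⟩
      · simp only [Function.comp]
        gcongr
    have hs := refl (polyBounded_size_pair (hNc.size_input.reindex (Below.idx (N := N)))
      (polyBounded_size_pair (polyBounded_size_num hN.pos) hsz))
    let r : Below N → Below N := fun z => ⟨(z.idx, N z.idx - 1 - z.pos), by
      have := z.pos_lt
      change N z.idx - 1 - z.pos < N z.idx
      omega⟩
    have hidx : Computes (m ∘ Below.idx (N := N)) _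
        fun z => .num (((N z.idx : ℤ) - 1) - z.pos) :=
      ((hs.fst.trans (hNc.reindex Below.idx)).sub (const hs.size_input 1)).sub hs.snd.fst
    have hval := (hs.fst.pair (hidx.congr (b' := fun z => .num ((r z).pos : ℕ)) fun z => by
      have := z.pos_lt
      simp only [r, Below.pos, Below.idx] at this ⊢
      congr 1
      omega)).trans (hx.reindex r)
    exact (hval.pair hs.snd.snd).congr fun z => (arr_snoc_front _ _ _ z.pos_lt).symm
  simpa using key

theorem sum {f : ι → ℕ → ℤ} (hN : PolyBounded m N) (hNc : Computes m a fun i => .num (N i))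
    (hf : Computes (m ∘ Below.idx (N := N)) (fun z => .pair (a z.idx) (.num z.pos))
      (fun z => .num (f z.idx z.pos))) :
    Computes m a fun i => .num (∑ k ∈ Finset.range (N i), f i k) := by
  obtain ⟨P, hP⟩ := hf.size_output
  refine iterate (st := fun i j => .num (∑ k ∈ Finset.range j, f i k)) hN hNc
    (by simpa using const hNc.size_input 0) ?_
  have hsz : PolyBounded (m ∘ Below.idx (N := N))
      fun z => (Data.num (∑ k ∈ Finset.range z.pos, f z.idx k)).size := by
    refine ((hN.add ⟨P, fun _ => le_rfl⟩).add (.const m 2)).reindex (Below.idx (N := N)) |>.mono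
      fun z => ?_
    have hz := z.pos_lt
    have := natSize_natAbs_sum_le (f := f z.idx) (n := z.pos) (s := P.eval (m z.idx)) fun k hk =>
      (Nat.le_succ _).trans (hP ⟨(z.idx, k), hk.trans hz⟩)
    simp only [Data.size, Function.comp]
    omega
  have hs := refl (polyBounded_size_pair (hNc.size_input.reindex (Below.idx (N := N)))
    (polyBounded_size_pair (polyBounded_size_num hN.pos) hsz))
  exact (hs.snd.snd.add ((hs.fst.pair hs.snd.fst).trans hf)).congr fun z => by
    rw [Finset.sum_range_succ]

/-- The exponent itself, not just its bit size, has to be polynomially bounded, since the number of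
bits of the power grows in proportion to it. -/
theorem pow {e : ι → ℤ} (hN : PolyBounded m N) (hNc : Computes m a fun i => .num (N i))
    (he : Computes m a fun i => .num (e i)) :
    Computes m a fun i => .num (e i ^ N i) := by
  obtain ⟨P, hP⟩ := he.size_output
  refine iterate (st := fun i j => .num (e i ^ j)) hN hNc
    (by simpa using const hNc.size_input 1) ?_
  have hpow : ∀ (i : ι) (j : ℕ), Nat.size (e i ^ j).natAbs ≤ j * P.eval (m i) + 1 := by
    intro i j
    induction j with
    | zero => simp
    | succ j ih =>
      rw [pow_succ, Int.natAbs_mul]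
      refine (natSize_mul_le _ _).trans ?_
      have := hP i
      simp only [Data.size] at this
      rw [add_mul]
      omega
  have hsz : PolyBounded (m ∘ Below.idx (N := N))
      fun z => (Data.num (e z.idx ^ z.pos)).size := by
    refine ((hN.mul ⟨P, fun _ => le_rfl⟩).add (.const m 2)).reindex (Below.idx (N := N)) |>.mono
      fun z => ?_
    have := hpow z.idx z.pos
    have := Nat.mul_le_mul_right (P.eval (m z.idx)) z.pos_lt.le
    simp only [Data.size, Function.comp]
    omega
  have hs := refl (polyBounded_size_pair (hNc.size_input.reindex (Below.idx (N := N)))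
    (polyBounded_size_pair (polyBounded_size_num hN.pos) hsz))
  exact (hs.snd.snd.mul (hs.fst.trans (he.reindex Below.idx))).congr fun z => by
    simp [pow_succ]

end Computes

/-! ### The dual of the log-partition function -/

section Family

variable {p : ℕ} {h : (Fin p → Bool) → ℝ} {K : ℝ}

theorem weight_pos (hpos : ∀ x, 0 < h x) (θ : EuclideanSpace ℝ (Fin p)) (x : Fin p → Bool) :
    0 < weight h θ x := mul_pos (hpos x) (Real.exp_pos _)

theorem partitionFn_pos (hpos : ∀ x, 0 < h x) (θ : EuclideanSpace ℝ (Fin p)) :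
    0 < partitionFn h θ :=
  Finset.sum_pos (fun x _ => weight_pos hpos θ x) Finset.univ_nonempty

theorem moment_mul_partitionFn (hpos : ∀ x, 0 < h x) (θ : EuclideanSpace ℝ (Fin p)) (i : Fin p) :
    moment h θ i * partitionFn h θ = ∑ x, weight h θ x * bit (x i) := by
  have := (partitionFn_pos hpos θ).ne'
  simp only [moment, expect, Finset.sum_mul]
  refine Finset.sum_congr rfl fun x _ => ?_
  field_simp

theorem one_sub_moment_mul_partitionFn (hpos : ∀ x, 0 < h x) (θ : EuclideanSpace ℝ (Fin p))
    (i : Fin p) :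
    (1 - moment h θ i) * partitionFn h θ = ∑ x, weight h θ x * bit (!x i) := by
  rw [sub_mul, moment_mul_partitionFn hpos, one_mul, partitionFn, ← Finset.sum_sub_distrib]
  refine Finset.sum_congr rfl fun x _ => ?_
  cases x i <;> simp [bit]

theorem moment_nonneg (hpos : ∀ x, 0 < h x) (θ : EuclideanSpace ℝ (Fin p)) (i : Fin p) :
    0 ≤ moment h θ i := by
  refine nonneg_of_mul_nonneg_left ?_ (partitionFn_pos hpos θ)
  rw [moment_mul_partitionFn hpos]
  refine Finset.sum_nonneg fun x _ => mul_nonneg (weight_pos hpos θ x).le ?_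
  cases x i <;> simp [bit]

theorem moment_le_one (hpos : ∀ x, 0 < h x) (θ : EuclideanSpace ℝ (Fin p)) (i : Fin p) :
    moment h θ i ≤ 1 := by
  rw [← sub_nonneg]
  refine nonneg_of_mul_nonneg_left ?_ (partitionFn_pos hpos θ)
  rw [one_sub_moment_mul_partitionFn hpos]
  refine Finset.sum_nonneg fun x _ => mul_nonneg (weight_pos hpos θ x).le ?_
  cases x i <;> simp [bit]

/-- The moment is a subgradient of the log-partition function. -/
theorem log_partitionFn_add_le (hpos : ∀ x, 0 < h x) (θ θ' : EuclideanSpace ℝ (Fin p)) :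
    Real.log (partitionFn h θ) + ∑ i, (θ' i - θ i) * moment h θ i ≤
      Real.log (partitionFn h θ') := by
  have hZ := partitionFn_pos hpos θ
  have hmean : ∑ x, (weight h θ x / partitionFn h θ) • (∑ i, (θ' i - θ i) * bit (x i)) =
      ∑ i, (θ' i - θ i) * moment h θ i := by
    simp only [smul_eq_mul, moment, expect, Finset.mul_sum]
    rw [Finset.sum_comm]
    refine Finset.sum_congr rfl fun i _ => Finset.sum_congr rfl fun x _ => by ring
  -- Jensen's inequality for `exp` of `⟨θ' - θ, X⟩` under `p_θ`; the mean of this exponential is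
  -- `Z(θ') / Z(θ)`.
  have hconv := convexOn_exp.map_sum_le (t := Finset.univ)
    (w := fun x => weight h θ x / partitionFn h θ)
    (p := fun x : Fin p → Bool => ∑ i, (θ' i - θ i) * bit (x i))
    (fun x _ => (div_pos (weight_pos hpos θ x) hZ).le)
    (by rw [← Finset.sum_div]; exact div_self hZ.ne') (fun _ _ => Set.mem_univ _)
  rw [hmean] at hconv
  have hsum : ∑ x, (weight h θ x / partitionFn h θ) •
      Real.exp (∑ i, (θ' i - θ i) * bit (x i)) = partitionFn h θ' / partitionFn h θ := by
    rw [partitionFn.eq_def h θ', Finset.sum_div]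
    refine Finset.sum_congr rfl fun x _ => ?_
    simp only [weight, smul_eq_mul, sub_mul, Finset.sum_sub_distrib, Real.exp_sub]
    field_simp
  rw [hsum, ← Real.le_log_iff_exp_le (div_pos (partitionFn_pos hpos θ') hZ),
    Real.log_div (partitionFn_pos hpos θ').ne' hZ.ne'] at hconv
  linarith

/-- The value at `τ_*(θ)` of the concave conjugate `τ ↦ min_θ (log Z(θ) - ⟨θ, τ⟩)`. -/
noncomputable def dualValue (h : (Fin p → Bool) → ℝ) (θ : EuclideanSpace ℝ (Fin p)) : ℝ :=
  Real.log (partitionFn h θ) - ∑ i, θ i * moment h θ i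

theorem dualValue_zero : dualValue h 0 = Real.log (partitionFn h 0) := by
  simp [dualValue]

/-- Supergradient inequality with slope `-θ` at `τ_*(θ)`: any `θ` is a candidate in the minimum that
defines the conjugate at `τ_*(θ')`. The ascent and the integration both rest on it. -/
theorem dualValue_le (hpos : ∀ x, 0 < h x) (θ θ' : EuclideanSpace ℝ (Fin p)) :
    dualValue h θ' ≤ dualValue h θ - ∑ i, θ i * (moment h θ' i - moment h θ i) := by
  have := log_partitionFn_add_le hpos θ' θ
  simp only [dualValue, sub_mul, mul_sub, Finset.sum_sub_distrib] at *
  linarith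

/-! ### Bounds on the natural parameters by bit flips -/

/-- Switching the `i`-th bit. -/
def flipBit (i : Fin p) (x : Fin p → Bool) : Fin p → Bool := Function.update x i (!x i)

theorem flipBit_involutive (i : Fin p) : Function.Involutive (flipBit i) := by
  intro x
  simp [flipBit]

theorem sum_flipBit (i : Fin p) (f : (Fin p → Bool) → ℝ) : ∑ x, f (flipBit i x) = ∑ x, f x :=
  Equiv.sum_comp (flipBit_involutive i).toPerm f

theorem le_exp_mul_of_log (hpos : ∀ x, 0 < h x)
    (hK : ∀ x y, |Real.log (h x) - Real.log (h y)| ≤ K) (x y : Fin p → Bool) :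
    h x ≤ Real.exp K * h y := by
  have h1 := (abs_le.1 (hK x y)).2
  rw [← Real.log_le_log_iff (hpos x) (mul_pos (Real.exp_pos _) (hpos y)),
    Real.log_mul (Real.exp_pos _).ne' (hpos y).ne', Real.log_exp]
  linarith

theorem exponent_flipBit (θ : EuclideanSpace ℝ (Fin p)) (i : Fin p) (x : Fin p → Bool)
    (hx : x i = false) :
    ∑ j, θ j * bit (flipBit i x j) = θ i + ∑ j, θ j * bit (x j) := by
  rw [← Finset.add_sum_erase _ _ (Finset.mem_univ i),
    ← Finset.add_sum_erase _ (fun j => θ j * bit (x j)) (Finset.mem_univ i)]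
  have : ∑ j ∈ Finset.univ.erase i, θ j * bit (flipBit i x j) =
      ∑ j ∈ Finset.univ.erase i, θ j * bit (x j) :=
    Finset.sum_congr rfl fun j hj => by simp [flipBit, (Finset.mem_erase.1 hj).1]
  rw [this]
  simp [flipBit, hx, bit]

theorem moment_mul_eq_flip (hpos : ∀ x, 0 < h x) (θ : EuclideanSpace ℝ (Fin p)) (i : Fin p) :
    moment h θ i * partitionFn h θ = ∑ x, weight h θ (flipBit i x) * bit (!x i) := by
  rw [moment_mul_partitionFn hpos, ← sum_flipBit i]
  simp [flipBit]

/-- Flipping bit `i` of a point with `x i = false` multiplies its weight by `e^{θ_i}` and a ratio of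
values of `h`, which is at most `e^K`. Summing over such points compares the masses of the two
values of the bit. -/
theorem moment_le_exp_mul (hpos : ∀ x, 0 < h x)
    (hK : ∀ x y, |Real.log (h x) - Real.log (h y)| ≤ K) (θ : EuclideanSpace ℝ (Fin p))
    (i : Fin p) : moment h θ i ≤ Real.exp (K + θ i) * (1 - moment h θ i) := by
  refine le_of_mul_le_mul_right ?_ (partitionFn_pos hpos θ)
  rw [mul_assoc, one_sub_moment_mul_partitionFn hpos, moment_mul_eq_flip hpos, Finset.mul_sum]
  refine Finset.sum_le_sum fun x _ => ?_
  cases hx : x i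
  · simp only [show bit (!false) = 1 by simp [bit], mul_one, weight, exponent_flipBit θ i x hx,
      Real.exp_add]
    have := mul_le_mul_of_nonneg_right (le_exp_mul_of_log hpos hK (flipBit i x) x)
      (mul_pos (Real.exp_pos (θ i)) (Real.exp_pos (∑ j, θ j * bit (x j)))).le
    linarith
  · simp [bit]

theorem exp_mul_le_moment (hpos : ∀ x, 0 < h x)
    (hK : ∀ x y, |Real.log (h x) - Real.log (h y)| ≤ K) (θ : EuclideanSpace ℝ (Fin p))
    (i : Fin p) : Real.exp (θ i) * (1 - moment h θ i) ≤ Real.exp K * moment h θ i := by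
  refine le_of_mul_le_mul_right ?_ (partitionFn_pos hpos θ)
  rw [mul_assoc, mul_assoc, one_sub_moment_mul_partitionFn hpos, moment_mul_eq_flip hpos,
    Finset.mul_sum, Finset.mul_sum]
  refine Finset.sum_le_sum fun x _ => ?_
  cases hx : x i
  · simp only [show bit (!false) = 1 by simp [bit], mul_one, weight, exponent_flipBit θ i x hx,
      Real.exp_add]
    have := mul_le_mul_of_nonneg_right (le_exp_mul_of_log hpos hK x (flipBit i x))
      (mul_pos (Real.exp_pos (θ i)) (Real.exp_pos (∑ j, θ j * bit (x j)))).le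
    linarith
  · simp [bit]

/-- The natural parameters are bounded where the marginals stay away from `0` and `1`. -/
theorem abs_param_le (hpos : ∀ x, 0 < h x)
    (hK : ∀ x y, |Real.log (h x) - Real.log (h y)| ≤ K) (θ : EuclideanSpace ℝ (Fin p))
    (i : Fin p) {r : ℝ} (hr : 0 < r) (h1 : r⁻¹ ≤ moment h θ i) (h2 : moment h θ i ≤ 1 - r⁻¹) :
    |θ i| ≤ K + Real.log r := by
  have hr' : 0 < r⁻¹ := inv_pos.2 hr
  have hexp : Real.exp (-Real.log r) = r⁻¹ := by rw [Real.exp_neg, Real.exp_log hr]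
  rw [abs_le]
  constructor
  · have := moment_le_exp_mul hpos hK θ i
    have h3 : Real.exp (-Real.log r) ≤ Real.exp (K + θ i) := by
      rw [hexp]
      nlinarith [Real.exp_pos (K + θ i)]
    have := Real.exp_le_exp.1 h3
    linarith
  · have := exp_mul_le_moment hpos hK θ i
    have h3 : Real.exp (θ i) * Real.exp (-Real.log r) ≤ Real.exp K := by
      rw [hexp]
      nlinarith [Real.exp_pos (θ i), Real.exp_pos K]
    rw [← Real.exp_add] at h3
    have := Real.exp_le_exp.1 h3
    linarith

/-! ### The dual near the corner `τ = 0` -/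

theorem sum_exp_bits (c : ℝ) :
    ∑ x : Fin p → Bool, Real.exp (∑ i, c * bit (x i)) = (1 + Real.exp c) ^ p := by
  simp only [Real.exp_sum]
  rw [← Fintype.prod_sum (fun (_ : Fin p) (b : Bool) => Real.exp (c * bit b))]
  simp [bit, add_comm]

/-- The minimum is tested at the constant vector with entries `-(K + log r)`. For `x ≠ 0` the factor
`e^{-K|x|}` absorbs the oscillation of `h`, leaving at most `h(0) r^{-|x|}`; these terms sum to
`h(0) (1 + 1/r)^p`. -/
theorem dualValue_le_of_moment_const (hpos : ∀ x, 0 < h x)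
    (hK : ∀ x y, |Real.log (h x) - Real.log (h y)| ≤ K) (θ : EuclideanSpace ℝ (Fin p))
    {r : ℝ} (hr : 0 < r) (hm : ∀ i, moment h θ i = r⁻¹) :
    dualValue h θ ≤ Real.log (h fun _ => false) + p * r⁻¹ * (1 + K + Real.log r) := by
  have hK0 : 0 ≤ K := (abs_nonneg _).trans (hK (fun _ => false) fun _ => false)
  let c : ℝ := -(K + Real.log r)
  let θ' : EuclideanSpace ℝ (Fin p) := WithLp.toLp 2 fun _ => c
  have hc : Real.exp c ≤ r⁻¹ := by
    rw [← Real.exp_log (inv_pos.2 hr), Real.log_inv]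
    exact Real.exp_le_exp.2 (by simp only [c]; linarith)
  have hZ : partitionFn h θ' ≤ (h fun _ => false) * (1 + r⁻¹) ^ p := by
    have h1 : ∀ x, weight h θ' x ≤
        (h fun _ => false) * Real.exp (∑ i, (-Real.log r) * bit (x i)) := by
      intro x
      by_cases hx : x = fun _ => false
      · subst hx
        simp [weight, bit]
      · obtain ⟨j, hj⟩ : ∃ j, x j = true := by
          by_contra hcon
          push Not at hcon
          exact hx (funext fun j => by simpa using hcon j)
        have hn : 1 ≤ ∑ i, bit (x i) := by
          have := Finset.single_le_sum (f := fun i => bit (x i))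
            (fun i _ => by cases x i <;> simp [bit]) (Finset.mem_univ j)
          simpa [hj, bit] using this
        have hle := le_exp_mul_of_log hpos hK x fun _ => false
        have hsplit : ∑ i, θ' i * bit (x i) =
            -(K * ∑ i, bit (x i)) + ∑ i, (-Real.log r) * bit (x i) := by
          simp only [θ', c, ← Finset.mul_sum]
          ring
        rw [weight, hsplit, Real.exp_add, ← mul_assoc]
        refine mul_le_mul_of_nonneg_right ?_ (Real.exp_pos _).le
        calc h x * Real.exp (-(K * ∑ i, bit (x i)))
            ≤ (Real.exp K * h fun _ => false) * Real.exp (-K) := by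
              refine mul_le_mul hle (Real.exp_le_exp.2 (by nlinarith)) (Real.exp_pos _).le
                (mul_pos (Real.exp_pos _) (hpos _)).le
          _ = _ := by rw [mul_right_comm, ← Real.exp_add]; simp
    calc partitionFn h θ' ≤ ∑ x : Fin p → Bool,
          (h fun _ => false) * Real.exp (∑ i, (-Real.log r) * bit (x i)) :=
          Finset.sum_le_sum fun x _ => h1 x
      _ = _ := by rw [← Finset.mul_sum, sum_exp_bits, Real.exp_neg, Real.exp_log hr]
  have hlog : Real.log (partitionFn h θ') ≤ Real.log (h fun _ => false) + p * r⁻¹ := by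
    refine (Real.log_le_log (partitionFn_pos hpos θ') hZ).trans ?_
    have hp1 : 0 < 1 + r⁻¹ := by positivity
    rw [Real.log_mul (hpos _).ne' (pow_pos hp1 p).ne', Real.log_pow]
    have := Real.log_le_sub_one_of_pos hp1
    have : (p : ℝ) * Real.log (1 + r⁻¹) ≤ p * r⁻¹ := by gcongr; linarith
    linarith
  have hJ := log_partitionFn_add_le hpos θ θ'
  have hsum : ∑ i, (θ' i - θ i) * moment h θ i = p * (c * r⁻¹) - ∑ i, θ i * moment h θ i := by
    simp only [sub_mul, Finset.sum_sub_distrib, hm]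
    simp [θ']
  rw [hsum] at hJ
  simp only [dualValue, c] at *
  linarith

/-- `Z(θ)` contains the term `h(0)`, and the linear term is small because the marginals are. -/
theorem le_dualValue_of_moment_const (hpos : ∀ x, 0 < h x) (θ : EuclideanSpace ℝ (Fin p))
    {r G : ℝ} (hr : 0 < r) (hm : ∀ i, moment h θ i = r⁻¹) (hG : ∀ i, |θ i| ≤ G) :
    Real.log (h fun _ => false) - p * r⁻¹ * G ≤ dualValue h θ := by
  have hr' : 0 < r⁻¹ := inv_pos.2 hr
  have h1 : (h fun _ => false) ≤ partitionFn h θ := by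
    have := Finset.single_le_sum (f := weight h θ) (fun x _ => (weight_pos hpos θ x).le)
      (Finset.mem_univ fun _ => false)
    simpa [weight, bit, partitionFn] using this
  have h2 := Real.log_le_log (hpos _) h1
  have h3 : ∑ i, θ i * moment h θ i ≤ p * (G * r⁻¹) := by
    calc ∑ i, θ i * moment h θ i ≤ ∑ _i : Fin p, G * r⁻¹ :=
          Finset.sum_le_sum fun i _ => by
            rw [hm i]
            exact mul_le_mul_of_nonneg_right ((le_abs_self _).trans (hG i)) hr'.le
      _ = _ := by simp
  simp only [dualValue]
  linarith

end Family

/-! ### Projected gradient ascent and integration along a segment -/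

/-- `g n D` approximates `W θ`, for some `θ` with `τ_*(θ) = n / D`. -/
def IsParamOracle {p : ℕ} (h : (Fin p → Bool) → ℝ) (W : ℕ) (g : (ℕ → ℤ) → ℕ → ℕ → ℤ) : Prop :=
  ∀ (n : ℕ → ℤ) (D : ℕ), (∀ j < p, 0 < n j ∧ n j < D) →
    ∃ θ : EuclideanSpace ℝ (Fin p), (∀ j : Fin p, moment h θ j = (n j : ℝ) / D) ∧
      ∀ j : Fin p, |(g n D j : ℝ) / W - θ j| ≤ 2 / W

/-- Projected gradient ascent on `{1, …, D - 1}^p`, with gradient `-g`, started at `(1, …, 1)`. -/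
def ascent (g : (ℕ → ℤ) → ℕ → ℕ → ℤ) (D : ℕ) : ℕ → ℕ → ℤ
  | 0 => fun _ => 1
  | t + 1 => fun j => max 1 (min ((D : ℤ) - 1) (ascent g D t j - g (ascent g D t) D j))

theorem one_le_ascent (g : (ℕ → ℤ) → ℕ → ℕ → ℤ) (D t j : ℕ) : 1 ≤ ascent g D t j := by
  cases t <;> simp [ascent]

theorem ascent_lt (g : (ℕ → ℤ) → ℕ → ℕ → ℤ) {D : ℕ} (hD : 2 ≤ D) (t j : ℕ) :
    ascent g D t j < D := by
  cases t <;> simp [ascent] <;> omega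

/-- The sum of the first `T` iterates. -/
def ascentSum (g : (ℕ → ℤ) → ℕ → ℕ → ℤ) (D T j : ℕ) : ℤ :=
  ∑ t ∈ Finset.range T, ascent g D t j

theorem le_ascentSum (g : (ℕ → ℤ) → ℕ → ℕ → ℤ) (D T j : ℕ) : (T : ℤ) ≤ ascentSum g D T j := by
  have := Finset.sum_le_sum (s := Finset.range T) fun t _ => one_le_ascent g D t j
  simpa [ascentSum] using this

theorem ascentSum_le (g : (ℕ → ℤ) → ℕ → ℕ → ℤ) {D : ℕ} (hD : 2 ≤ D) (T j : ℕ) :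
    ascentSum g D T j ≤ T * ((D : ℤ) - 1) := by
  have := Finset.sum_le_sum (s := Finset.range T) (f := fun t => ascent g D t j)
    (g := fun _ => (D : ℤ) - 1) fun t _ => by have := ascent_lt g hD t j; omega
  simpa only [ascentSum, Finset.sum_const, Finset.card_range, nsmul_eq_mul] using this

/-- Projection onto `[1, D - 1]` does not increase the distance to `u`, so a round changes `(n -
u)^2` by at most `-2 g (n - u) + g^2`, and this telescopes. Subtracting `g ≈ W θ` from a numerator
over `D` keeps the iterates integral; in the scale of `τ` the step size is `W / D`. -/
theorem regret_le (g : (ℕ → ℤ) → ℕ → ℕ → ℤ) {D : ℕ} (hD : 2 ≤ D) (j : ℕ) {u b : ℝ}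
    (hu1 : 1 ≤ u) (hu2 : u ≤ D - 1) (hb : ∀ t, |(g (ascent g D t) D j : ℝ)| ≤ b) (T : ℕ) :
    2 * ∑ t ∈ Finset.range T, (g (ascent g D t) D j : ℝ) * (ascent g D t j - u) ≤
      (D : ℝ) ^ 2 + T * b ^ 2 := by
  have key : ∀ T : ℕ, 2 * ∑ t ∈ Finset.range T,
      (g (ascent g D t) D j : ℝ) * (ascent g D t j - u) ≤
      (1 - u) ^ 2 - (ascent g D T j - u) ^ 2 + T * b ^ 2 := by
    intro T
    induction T with
    | zero => simp [ascent]
    | succ T ih =>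
      rw [Finset.sum_range_succ]
      have hg : (g (ascent g D T) D j : ℝ) ^ 2 ≤ b ^ 2 := sq_le_sq' (by
        have := (abs_le.1 (hb T)).1; linarith) (abs_le.1 (hb T)).2
      have hproj : ((ascent g D (T + 1) j : ℝ) - u) ^ 2 ≤
          ((ascent g D T j : ℝ) - g (ascent g D T) D j - u) ^ 2 := by
        simp only [ascent]
        push_cast
        generalize (ascent g D T j : ℝ) - g (ascent g D T) D j = z
        rcases le_total ((D : ℝ) - 1) z with hz | hz
        · rw [min_eq_left hz, max_eq_right (by linarith)]
          nlinarith
        · rw [min_eq_right hz]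
          rcases le_total 1 z with hz' | hz'
          · rw [max_eq_right hz']
          · rw [max_eq_left hz']
            nlinarith
      push_cast
      nlinarith
  have h1 := key T
  have hD' : (2 : ℝ) ≤ D := by exact_mod_cast hD
  nlinarith [sq_nonneg ((ascent g D T j : ℝ) - u)]

section Analysis

variable {p : ℕ} {h : (Fin p → Bool) → ℝ} {W : ℕ} {g : (ℕ → ℤ) → ℕ → ℕ → ℤ}

/-- The average of the iterates nearly maximizes the dual. -/
theorem log_partitionFn_le_dualValue_average (hpos : ∀ x, 0 < h x) (hW : 0 < W)
    (hg : IsParamOracle h W g) {D T : ℕ} (hD : 2 ≤ D) (hT : 0 < T) {G : ℝ}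
    (hG : ∀ θ : EuclideanSpace ℝ (Fin p),
      (∀ i, (D : ℝ)⁻¹ ≤ moment h θ i ∧ moment h θ i ≤ 1 - (D : ℝ)⁻¹) → ∀ i, |θ i| ≤ G)
    {θ : EuclideanSpace ℝ (Fin p)}
    (hθ : ∀ j : Fin p, moment h θ j = (ascentSum g D T j : ℝ) / (T * D)) :
    Real.log (partitionFn h 0) ≤ dualValue h θ +
      p * ((D : ℝ) / (2 * W * T) + (W * G + 2) ^ 2 / (2 * W * D) + 2 / W + G / D) := by
  have hWr : (0 : ℝ) < W := by exact_mod_cast hW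
  have hDr : (2 : ℝ) ≤ D := by exact_mod_cast hD
  have hD0 : (0 : ℝ) < D := by linarith
  have hTr : (0 : ℝ) < T := by exact_mod_cast hT
  choose ϑ hϑm hϑg using fun t => hg (ascent g D t) D fun j _ =>
    ⟨one_le_ascent g D t j, ascent_lt g hD t j⟩
  have hϑG : ∀ t i, |ϑ t i| ≤ G := fun t => hG _ fun i => by
    have h1 : (1 : ℝ) ≤ ascent g D t i := by exact_mod_cast one_le_ascent g D t i
    have h2 : (ascent g D t i : ℝ) ≤ D - 1 := by
      have := ascent_lt g hD t i
      exact_mod_cast (by omega : ascent g D t i ≤ (D : ℤ) - 1)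
    rw [hϑm, inv_eq_one_div]
    refine ⟨by gcongr, ?_⟩
    rw [div_le_iff₀ hD0, sub_mul, one_div, inv_mul_cancel₀ hD0.ne']
    linarith
  have hgb : ∀ t (i : Fin p), |(g (ascent g D t) D i : ℝ)| ≤ W * G + 2 := fun t i => by
    have h1 := hϑg t i
    have h2 := hϑG t i
    have h3 : |(g (ascent g D t) D i : ℝ) / W| ≤ G + 2 / W := by
      have := abs_add_le ((g (ascent g D t) D i : ℝ) / W - ϑ t i) (ϑ t i)
      rw [sub_add_cancel] at this
      linarith
    rw [abs_div, abs_of_pos hWr, div_le_iff₀ hWr] at h3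
    calc _ ≤ _ := h3
      _ = W * G + 2 := by field_simp
  let μ : Fin p → ℝ := fun i => moment h 0 i
  -- The maximizer `μ` may lie outside the box of the ascent. Clamping moves each coordinate of `D
  -- μ` by at most 1, which costs `G / D`.
  let u : Fin p → ℝ := fun i => max 1 (min ((D : ℝ) - 1) (D * μ i))
  have hu1 : ∀ i, 1 ≤ u i := fun i => le_max_left _ _
  have hu2 : ∀ i, u i ≤ D - 1 := fun i => max_le (by linarith) (min_le_left _ _)
  have huμ : ∀ i, |u i - D * μ i| ≤ 1 := fun i => by
    have h0 : 0 ≤ μ i := moment_nonneg hpos 0 i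
    have h1 : μ i ≤ 1 := moment_le_one hpos 0 i
    have h2 : (D : ℝ) * μ i ≤ D := by nlinarith
    have h3 : 0 ≤ (D : ℝ) * μ i := by positivity
    simp only [u]
    rw [abs_le]
    rcases le_total ((D : ℝ) - 1) (D * μ i) with hz | hz
    · rw [min_eq_left hz, max_eq_right (by linarith)]
      constructor <;> linarith
    · rw [min_eq_right hz]
      rcases le_total 1 ((D : ℝ) * μ i) with hz' | hz'
      · rw [max_eq_right hz']
        constructor <;> linarith
      · rw [max_eq_left hz']
        constructor <;> linarith
  have hterm : ∀ t (i : Fin p), ϑ t i * (moment h (ϑ t) i - μ i) ≤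
      (g (ascent g D t) D i : ℝ) * (ascent g D t i - u i) / (W * D) + (2 / W + G / D) := by
    intro t i
    have h1 : (1 : ℝ) ≤ ascent g D t i := by exact_mod_cast one_le_ascent g D t i
    have h2 : (ascent g D t i : ℝ) ≤ D - 1 := by
      have := ascent_lt g hD t i
      exact_mod_cast (by omega : ascent g D t i ≤ (D : ℤ) - 1)
    have hA : |((ascent g D t i : ℝ) - u i) / D| ≤ 1 := by
      rw [abs_div, abs_of_pos hD0, div_le_one hD0, abs_le]
      constructor <;> linarith [hu1 i, hu2 i]
    have hB : (ϑ t i - (g (ascent g D t) D i : ℝ) / W) * (((ascent g D t i : ℝ) - u i) / D)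
        ≤ 2 / W := by
      refine (le_abs_self _).trans ?_
      rw [abs_mul, abs_sub_comm]
      exact (mul_le_mul (hϑg t i) hA (abs_nonneg _) (by positivity)).trans_eq (mul_one _)
    have hC : ϑ t i * ((u i - D * μ i) / D) ≤ G / D := by
      refine (le_abs_self _).trans ?_
      rw [abs_mul, abs_div, abs_of_pos hD0, mul_div_assoc']
      gcongr
      exact (mul_le_mul (hϑG t i) (huμ i) (abs_nonneg _)
        ((abs_nonneg _).trans (hϑG t i))).trans_eq (mul_one _)
    rw [hϑm]
    -- The three summands are the regret term, the oracle error and the clamping error.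
    have e : ϑ t i * ((ascent g D t i : ℝ) / D - μ i) =
        (g (ascent g D t) D i : ℝ) * (ascent g D t i - u i) / (W * D) +
        ((ϑ t i - (g (ascent g D t) D i : ℝ) / W) * (((ascent g D t i : ℝ) - u i) / D) +
        ϑ t i * ((u i - D * μ i) / D)) := by
      field_simp
      ring
    rw [e]
    linarith
  -- The optimum is compared with iterate `t` through the slope at the iterate, and the iterate with
  -- the average through the slope at the average. The latter terms cancel over `t` (`hzero`), as in
  -- Jensen's inequality.
  have hstep : ∀ t, Real.log (partitionFn h 0) ≤ dualValue h θ -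
      ∑ i, θ i * (moment h (ϑ t) i - moment h θ i) +
      ∑ i : Fin p, ((g (ascent g D t) D i : ℝ) * (ascent g D t i - u i) / (W * D) +
        (2 / W + G / D)) := by
    intro t
    have h1 := dualValue_le hpos (ϑ t) 0
    have h2 := dualValue_le hpos θ (ϑ t)
    rw [dualValue_zero] at h1
    have h3 := Finset.sum_le_sum (s := Finset.univ) fun i _ => hterm t i
    have h4 : ∑ i, ϑ t i * (moment h 0 i - moment h (ϑ t) i) =
        -∑ i, ϑ t i * (moment h (ϑ t) i - μ i) := by
      rw [← Finset.sum_neg_distrib]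
      exact Finset.sum_congr rfl fun i _ => by simp only [μ]; ring
    linarith
  have hsum := Finset.sum_le_sum (s := Finset.range T) fun t _ => hstep t
  simp only [Finset.sum_add_distrib, Finset.sum_sub_distrib, Finset.sum_const, Finset.card_range,
    nsmul_eq_mul, Finset.card_univ, Fintype.card_fin] at hsum
  have hzero : ∑ t ∈ Finset.range T, ∑ i, θ i * (moment h (ϑ t) i - moment h θ i) = 0 := by
    rw [Finset.sum_comm]
    refine Finset.sum_eq_zero fun i _ => ?_
    rw [← Finset.mul_sum, Finset.sum_sub_distrib, hθ]
    simp only [hϑm, ← Finset.sum_div]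
    simp only [ascentSum, Finset.sum_const, Finset.card_range, nsmul_eq_mul]
    push_cast
    rw [mul_div_mul_left _ _ hTr.ne', sub_self, mul_zero]
  have hreg : ∑ t ∈ Finset.range T, ∑ i : Fin p,
      (g (ascent g D t) D i : ℝ) * (ascent g D t i - u i) / (W * D) ≤
      p * (((D : ℝ) ^ 2 + T * (W * G + 2) ^ 2) / (2 * W * D)) := by
    rw [Finset.sum_comm]
    calc _ ≤ ∑ _i : Fin p, ((D : ℝ) ^ 2 + T * (W * G + 2) ^ 2) / (2 * W * D) := by
          refine Finset.sum_le_sum fun i _ => ?_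
          have := regret_le g hD i (hu1 i) (hu2 i) (fun t => hgb t i) T
          rw [← Finset.sum_div, div_le_div_iff₀ (by positivity) (by positivity)]
          have hWD : (0 : ℝ) < W * D := by positivity
          nlinarith
      _ = _ := by simp
  rw [hzero] at hsum
  have hfin : (T : ℝ) * Real.log (partitionFn h 0) ≤ T * (dualValue h θ +
      p * ((D : ℝ) / (2 * W * T) + (W * G + 2) ^ 2 / (2 * W * D) + 2 / W + G / D)) := by
    have e : (T : ℝ) * (dualValue h θ +
      p * ((D : ℝ) / (2 * W * T) + (W * G + 2) ^ 2 / (2 * W * D) + 2 / W + G / D)) =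
      T * dualValue h θ + p * (((D : ℝ) ^ 2 + T * (W * G + 2) ^ 2) / (2 * W * D)) +
      T * (p * (2 / W) + p * (G / D)) := by
      field_simp
      ring
    rw [e]
    linarith
  exact le_of_mul_le_mul_left hfin hTr

/-- Left Riemann sums approximate the increment of the dual along a segment. -/
theorem abs_dualValue_sub_le (hpos : ∀ x, 0 < h x) {N : ℕ} (hN : 0 < N) {G w : ℝ}
    (ϑ : ℕ → EuclideanSpace ℝ (Fin p)) (Δ : Fin p → ℝ) (γ : ℕ → Fin p → ℝ)
    (hΔ : ∀ i, |Δ i| ≤ 1 / N)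
    (hm : ∀ k < N, ∀ i, moment h (ϑ (k + 1)) i - moment h (ϑ k) i = Δ i)
    (hG : ∀ k ≤ N, ∀ i, |ϑ k i| ≤ G) (hγ : ∀ k < N, ∀ i, |γ k i - ϑ k i| ≤ w) :
    |dualValue h (ϑ N) - dualValue h (ϑ 0) + ∑ k ∈ Finset.range N, ∑ i, γ k i * Δ i| ≤
      2 * p * G / N + p * w := by
  have hNr : (0 : ℝ) < N := by exact_mod_cast hN
  have hup : dualValue h (ϑ N) - dualValue h (ϑ 0) ≤
      -∑ k ∈ Finset.range N, ∑ i, ϑ k i * Δ i := by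
    rw [← Finset.sum_range_sub (fun k => dualValue h (ϑ k)), ← Finset.sum_neg_distrib]
    refine Finset.sum_le_sum fun k hk => ?_
    have := dualValue_le hpos (ϑ k) (ϑ (k + 1))
    simp only [hm k (Finset.mem_range.1 hk)] at this
    linarith
  have hlo : -∑ k ∈ Finset.range N, ∑ i, ϑ (k + 1) i * Δ i ≤
      dualValue h (ϑ N) - dualValue h (ϑ 0) := by
    rw [← Finset.sum_range_sub (fun k => dualValue h (ϑ k)), ← Finset.sum_neg_distrib]
    refine Finset.sum_le_sum fun k hk => ?_
    have := dualValue_le hpos (ϑ (k + 1)) (ϑ k)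
    have e : ∑ i, ϑ (k + 1) i * (moment h (ϑ k) i - moment h (ϑ (k + 1)) i) =
        -∑ i, ϑ (k + 1) i * Δ i := by
      rw [← Finset.sum_neg_distrib]
      refine Finset.sum_congr rfl fun i _ => ?_
      rw [← hm k (Finset.mem_range.1 hk) i]
      ring
    rw [e] at this
    linarith
  -- By concavity the left and right Riemann sums bracket the increment. Their difference telescopes
  -- to two boundary terms, so no smoothness of `θ` along the segment is needed.
  have htel : ∑ k ∈ Finset.range N, ∑ i, ϑ (k + 1) i * Δ i -
      ∑ k ∈ Finset.range N, ∑ i, ϑ k i * Δ i = ∑ i, ϑ N i * Δ i - ∑ i, ϑ 0 i * Δ i := by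
    rw [← Finset.sum_sub_distrib,
      Finset.sum_range_sub (fun k => ∑ i, ϑ k i * Δ i)]
  have hbd : ∀ k ≤ N, |∑ i, ϑ k i * Δ i| ≤ p * (G * (1 / N)) := fun k hk => by
    refine (Finset.abs_sum_le_sum_abs _ _).trans ?_
    calc _ ≤ ∑ _i : Fin p, G * (1 / N) := Finset.sum_le_sum fun i _ => by
          rw [abs_mul]
          exact mul_le_mul (hG k hk i) (hΔ i) (abs_nonneg _) ((abs_nonneg _).trans (hG k hk i))
      _ = _ := by simp
  have hγsum : |∑ k ∈ Finset.range N, ∑ i, γ k i * Δ i -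
      ∑ k ∈ Finset.range N, ∑ i, ϑ k i * Δ i| ≤ p * w := by
    rw [← Finset.sum_sub_distrib]
    refine (Finset.abs_sum_le_sum_abs _ _).trans ?_
    calc _ ≤ ∑ _k ∈ Finset.range N, (p : ℝ) * (w * (1 / N)) := by
          refine Finset.sum_le_sum fun k hk => ?_
          rw [← Finset.sum_sub_distrib]
          refine (Finset.abs_sum_le_sum_abs _ _).trans ?_
          calc _ ≤ ∑ _i : Fin p, w * (1 / N) := Finset.sum_le_sum fun i _ => by
                have := hγ k (Finset.mem_range.1 hk) i
                rw [← sub_mul, abs_mul]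
                exact mul_le_mul this (hΔ i) (abs_nonneg _) ((abs_nonneg _).trans this)
            _ = _ := by simp
      _ = p * w := by
          simp only [Finset.sum_const, Finset.card_range, nsmul_eq_mul]
          field_simp
  have h1 := abs_le.1 (hbd N le_rfl)
  have h2 := abs_le.1 (hbd 0 (Nat.zero_le _))
  have h3 := abs_le.1 hγsum
  have e : 2 * p * G / N = 2 * (p * (G * (1 / (N : ℝ)))) := by ring
  rw [e, abs_le]
  constructor <;> linarith

/-- The numerators, over `N T D`, of the `k`-th of `N` equidistant points on the segment from
`(1 / D, …, 1 / D)` to `S / (T D)`. -/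
def linePoint (T N : ℕ) (S : ℕ → ℤ) (k j : ℕ) : ℤ := ((N : ℤ) - k) * T + k * S j

/-- The Riemann sum along the segment, up to the factor `1 / (W N T D)`. -/
def lineSum (p : ℕ) (g : (ℕ → ℤ) → ℕ → ℕ → ℤ) (T N D : ℕ) (S : ℕ → ℤ) : ℤ :=
  ∑ k ∈ Finset.range N, ∑ j ∈ Finset.range p, g (linePoint T N S k) (N * T * D) j * (S j - T)

theorem linePoint_bounds {T N D k : ℕ} {S : ℕ → ℤ} {j : ℕ} (hk : k ≤ N)
    (h1 : (T : ℤ) ≤ S j) (h2 : S j ≤ T * ((D : ℤ) - 1)) (hD : 2 ≤ D) :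
    (N : ℤ) * T ≤ linePoint T N S k j ∧ linePoint T N S k j ≤ N * T * ((D : ℤ) - 1) := by
  obtain ⟨l, rfl⟩ := Nat.exists_eq_add_of_le hk
  have hD' : (0 : ℤ) ≤ (D : ℤ) - 2 := by omega
  have hT : (0 : ℤ) ≤ T := Int.natCast_nonneg T
  have hl : (0 : ℤ) ≤ l := Int.natCast_nonneg l
  have hk' : (0 : ℤ) ≤ k := Int.natCast_nonneg k
  have e1 := mul_le_mul_of_nonneg_left h1 hk'
  have e2 := mul_le_mul_of_nonneg_left h2 hk'
  have e3 := mul_nonneg (mul_nonneg hl hT) hD'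
  simp only [linePoint]
  push_cast
  constructor <;> linarith

/-- The three errors are those of the value near the corner, of the Riemann sum, and of the
optimization at the far end. The bound on `|y|` serves to control the later exponentiation. -/
theorem abs_log_partitionFn_sub_le {K : ℝ} (hpos : ∀ x, 0 < h x)
    (hK : ∀ x y, |Real.log (h x) - Real.log (h y)| ≤ K) (hW : 0 < W)
    (hg : IsParamOracle h W g) {D T N : ℕ} (hD : 2 ≤ D) (hT : 0 < T) (hN : 0 < N) {G : ℝ}
    (hGdef : G = K + Real.log D) {y : ℝ}
    (hy : y = (lineSum p g T N D (ascentSum g D T) : ℝ) / (W * (N * T * D))) :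
    |Real.log (partitionFn h 0) - (Real.log (h fun _ => false) - y)| ≤
      p * (1 + G) / D + (2 * p * G / N + p * (2 / W)) +
      p * ((D : ℝ) / (2 * W * T) + (W * G + 2) ^ 2 / (2 * W * D) + 2 / W + G / D) ∧
    |y| ≤ p * (G + 2 / W) := by
  have hWr : (0 : ℝ) < W := by exact_mod_cast hW
  have hDr : (2 : ℝ) ≤ D := by exact_mod_cast hD
  have hD0 : (0 : ℝ) < D := by linarith
  have hTr : (0 : ℝ) < T := by exact_mod_cast hT
  have hNr : (0 : ℝ) < N := by exact_mod_cast hN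
  have hbox : ∀ θ : EuclideanSpace ℝ (Fin p),
      (∀ i, (D : ℝ)⁻¹ ≤ moment h θ i ∧ moment h θ i ≤ 1 - (D : ℝ)⁻¹) → ∀ i, |θ i| ≤ G :=
    fun θ hθ i => hGdef ▸ abs_param_le hpos hK θ i hD0 (hθ i).1 (hθ i).2
  set S := ascentSum g D T with hS
  have hS1 : ∀ j, (T : ℤ) ≤ S j := fun j => le_ascentSum g D T j
  have hS2 : ∀ j, S j ≤ T * ((D : ℤ) - 1) := fun j => ascentSum_le g hD T j
  have hlp : ∀ k ≤ N, ∀ j, (N : ℤ) * T ≤ linePoint T N S k j ∧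
      linePoint T N S k j ≤ N * T * ((D : ℤ) - 1) :=
    fun k hk j => linePoint_bounds hk (hS1 j) (hS2 j) hD
  have hNT : (0 : ℤ) < N * T := by positivity
  -- The guard `k ≤ N` sits inside the existential so that `choose` yields a sequence on all of `ℕ`;
  -- its values beyond `N` play no role.
  have hex : ∀ k, ∃ θ : EuclideanSpace ℝ (Fin p), k ≤ N →
      (∀ j : Fin p, moment h θ j = (linePoint T N S k j : ℝ) / (N * T * D : ℕ)) ∧
      ∀ j : Fin p, |(g (linePoint T N S k) (N * T * D) j : ℝ) / W - θ j| ≤ 2 / W := by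
    intro k
    by_cases hk : k ≤ N
    · obtain ⟨θ, h1, h2⟩ := hg (linePoint T N S k) (N * T * D) fun j _ => by
        have := hlp k hk j
        push_cast
        constructor
        · linarith
        · linarith
      exact ⟨θ, fun _ => ⟨h1, h2⟩⟩
    · exact ⟨0, fun h => absurd h hk⟩
  choose ϑ hϑ using hex
  have hm : ∀ k ≤ N, ∀ i : Fin p,
      moment h (ϑ k) i = (((N : ℝ) - k) * T + k * S i) / (N * T * D) := fun k hk i => by
    rw [(hϑ k hk).1 i]
    simp [linePoint]
  have hG : ∀ k ≤ N, ∀ i, |ϑ k i| ≤ G := fun k hk => hbox _ fun i => by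
    obtain ⟨h1, h2⟩ := hlp k hk i
    have h1' : (N : ℝ) * T ≤ linePoint T N S k i := by exact_mod_cast h1
    have h2' : (linePoint T N S k i : ℝ) ≤ N * T * ((D : ℝ) - 1) := by exact_mod_cast h2
    rw [(hϑ k hk).1 i]
    push_cast
    constructor
    · rw [le_div_iff₀ (by positivity)]
      calc (D : ℝ)⁻¹ * (N * T * D) = N * T := by field_simp
        _ ≤ _ := h1'
    · rw [div_le_iff₀ (by positivity)]
      calc _ ≤ _ := h2'
        _ = _ := by field_simp
  let Δ : Fin p → ℝ := fun i => ((S i : ℝ) - T) / (N * T * D)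
  have hΔ : ∀ i, |Δ i| ≤ 1 / N := fun i => by
    have h1 : (T : ℝ) ≤ S i := by exact_mod_cast hS1 i
    have h2 : (S i : ℝ) ≤ T * ((D : ℝ) - 1) := by exact_mod_cast hS2 i
    rw [abs_of_nonneg (div_nonneg (by linarith) (by positivity)),
      div_le_div_iff₀ (by positivity) hNr]
    nlinarith
  let γ : ℕ → Fin p → ℝ := fun k i => (g (linePoint T N S k) (N * T * D) i : ℝ) / W
  have hyγ : ∑ k ∈ Finset.range N, ∑ i, γ k i * Δ i = y := by
    rw [hy, lineSum]
    push_cast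
    simp only [Finset.sum_div, Finset.sum_range, γ, Δ]
    refine Finset.sum_congr rfl fun k _ => Finset.sum_congr rfl fun i _ => ?_
    field_simp
  have hline := abs_dualValue_sub_le hpos hN ϑ Δ γ hΔ
    (fun k hk i => by
      rw [hm k hk.le, hm (k + 1) hk, ← sub_div]
      simp only [Δ]
      congr 1
      push_cast
      ring)
    hG (fun k hk i => (hϑ k hk.le).2 i)
  have hend := log_partitionFn_le_dualValue_average hpos hW hg hD hT hbox (θ := ϑ N)
    (fun j => by
      rw [hm N le_rfl, sub_self, zero_mul, zero_add, mul_assoc (N : ℝ),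
        mul_div_mul_left _ _ hNr.ne'])
  have hmax : dualValue h (ϑ N) ≤ Real.log (partitionFn h 0) := by
    have := dualValue_le hpos 0 (ϑ N)
    simpa [dualValue_zero] using this
  have hm0 : ∀ i, moment h (ϑ 0) i = (D : ℝ)⁻¹ := fun i => by
    rw [hm 0 (Nat.zero_le _)]
    simp only [Nat.cast_zero, sub_zero, zero_mul, add_zero]
    field_simp
  have hstart1 := dualValue_le_of_moment_const hpos hK (ϑ 0) hD0 hm0
  have hstart2 := le_dualValue_of_moment_const hpos (ϑ 0) hD0 hm0 (hG 0 (Nat.zero_le _))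
  have hpD : 0 ≤ (p : ℝ) * (D : ℝ)⁻¹ := by positivity
  have hc1 : (p : ℝ) * (D : ℝ)⁻¹ * (1 + K + Real.log D) = p * (1 + G) / D := by
    rw [hGdef]
    ring
  have hc2 : (p : ℝ) * (D : ℝ)⁻¹ * G ≤ p * (1 + G) / D := by
    rw [← hc1, hGdef]
    exact mul_le_mul_of_nonneg_left (by linarith) hpD
  rw [hyγ, abs_le] at hline
  rw [hc1] at hstart1
  constructor
  · rw [abs_le]
    constructor <;> linarith
  · rw [← hyγ]
    refine (Finset.abs_sum_le_sum_abs _ _).trans ?_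
    calc _ ≤ ∑ _k ∈ Finset.range N, (p : ℝ) * ((G + 2 / W) * (1 / N)) := by
          refine Finset.sum_le_sum fun k hk => ?_
          refine (Finset.abs_sum_le_sum_abs _ _).trans ?_
          calc _ ≤ ∑ _i : Fin p, (G + 2 / W) * (1 / N) := Finset.sum_le_sum fun i _ => by
                have hkN := (Finset.mem_range.1 hk).le
                have h1 : |γ k i - ϑ k i| ≤ 2 / W := (hϑ k hkN).2 i
                have h2 := hG k hkN i
                have h3 := abs_add_le (γ k i - ϑ k i) (ϑ k i)
                rw [sub_add_cancel] at h3
                rw [abs_mul]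
                exact mul_le_mul (by linarith) (hΔ i) (abs_nonneg _) (by
                  linarith [abs_nonneg (γ k i)])
            _ = _ := by simp
      _ = _ := by
          simp only [Finset.sum_const, Finset.card_range, nsmul_eq_mul]
          field_simp

end Analysis

/-! ### Exponentiation by powers and the choice of parameters -/

theorem abs_log_one_add_sub_le {z : ℝ} (hz : |z| ≤ 1 / 2) :
    |Real.log (1 + z) - z| ≤ 2 * z ^ 2 := by
  obtain ⟨h1, h2⟩ := abs_le.1 hz
  have hpos : 0 < 1 + z := by linarith
  have hup := Real.log_le_sub_one_of_pos hpos
  have hlo := Real.one_sub_inv_le_log_of_pos hpos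
  have : z - 2 * z ^ 2 ≤ 1 - (1 + z)⁻¹ := by
    rw [← sub_nonneg]
    have e : 1 - (1 + z)⁻¹ - (z - 2 * z ^ 2) = z ^ 2 * (1 + 2 * z) / (1 + z) := by
      field_simp
      ring
    rw [e]
    exact div_nonneg (mul_nonneg (sq_nonneg z) (by linarith)) hpos.le
  rw [abs_le]
  constructor <;> nlinarith [sq_nonneg z]

/-- The approximation of `exp` by powers, on the logarithmic scale. -/
theorem abs_log_one_sub_div_pow_sub_le {y : ℝ} {M : ℕ} (hM : 0 < M) (hy : |y| ≤ M / 2) :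
    0 < 1 - y / M ∧ |Real.log ((1 - y / M) ^ M) + y| ≤ 2 * y ^ 2 / M := by
  have hMr : (0 : ℝ) < M := by exact_mod_cast hM
  have hz : |-(y / M)| ≤ 1 / 2 := by
    rw [abs_neg, abs_div, abs_of_pos hMr, div_le_iff₀ hMr]
    linarith
  have h1 := abs_log_one_add_sub_le hz
  refine ⟨by linarith [(abs_le.1 hz).1], ?_⟩
  rw [Real.log_pow, sub_eq_add_neg]
  have e : (M : ℝ) * Real.log (1 + -(y / M)) + y =
      M * (Real.log (1 + -(y / M)) - -(y / M)) := by
    field_simp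
    ring
  rw [e, abs_mul, abs_of_pos hMr]
  calc _ ≤ (M : ℝ) * (2 * (-(y / M)) ^ 2) := by gcongr
    _ = _ := by field_simp

/-- The accuracy of the estimate, for one choice of the parameters. -/
theorem abs_log_estimate_sub_le {p : ℕ} {h : (Fin p → Bool) → ℝ} {K : ℝ} {Q : ℕ}
    {g : (ℕ → ℤ) → ℕ → ℕ → ℤ} (hpos : ∀ x, 0 < h x)
    (hK : ∀ x y, |Real.log (h x) - Real.log (h y)| ≤ K) (hpQ : p ≤ Q) (hKQ : K ≤ Q)
    (hQ : 1000 ≤ Q) (hg : IsParamOracle h (Q ^ 2) g) {y v : ℝ}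
    (hy : y = (lineSum p g (Q ^ 8) (Q ^ 4) (Q ^ 7) (ascentSum g (Q ^ 7) (Q ^ 8)) : ℝ) /
      (Q ^ 2 * (Q ^ 4 * Q ^ 8 * Q ^ 7)))
    (hv : |Real.log v - Real.log (h fun _ => false)| ≤ 1 / Q) (hv0 : 0 < v) :
    0 < 1 - y / Q ^ 7 ∧
    |Real.log (v * (1 - y / Q ^ 7) ^ Q ^ 7) - Real.log (partitionFn h 0)| ≤ 10 / Q := by
  have hQr : (1000 : ℝ) ≤ Q := by exact_mod_cast hQ
  have hQ0 : (0 : ℝ) < Q := by linarith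
  have hK0 : 0 ≤ K := (abs_nonneg _).trans (hK (fun _ => false) fun _ => false)
  have hpr : (p : ℝ) ≤ Q := by exact_mod_cast hpQ
  have hp0 : (0 : ℝ) ≤ p := by positivity
  have hD2 : 2 ≤ Q ^ 7 := le_trans (by omega) (Nat.le_self_pow (by norm_num) Q)
  -- With `p ≤ Q` and `G ≤ 8Q`: `W = Q^2` makes the oracle error `2p/W` at most `2/Q`. Then `D =
  -- Q^7` brings `p W G^2 / D`, `T = Q^8` brings `p D / (W T)`, and `N = Q^4` brings `p G / N` down
  -- to order `Q^{-2}`.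
  obtain ⟨h1, h2⟩ := abs_log_partitionFn_sub_le hpos hK (by positivity) hg hD2
    (T := Q ^ 8) (by positivity) (N := Q ^ 4) (by positivity) (G := K + Real.log ((Q ^ 7 : ℕ) : ℝ))
    rfl (y := y) (by rw [hy]; push_cast; rfl)
  have hlog0 : 0 ≤ Real.log ((Q ^ 7 : ℕ) : ℝ) := Real.log_natCast_nonneg _
  have hlog : Real.log ((Q ^ 7 : ℕ) : ℝ) ≤ 7 * Q := by
    push_cast
    rw [Real.log_pow]
    have := Real.log_le_sub_one_of_pos hQ0
    push_cast
    linarith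
  set G := K + Real.log ((Q ^ 7 : ℕ) : ℝ) with hGdef
  have hG0 : 0 ≤ G := by linarith
  have hG8 : G ≤ 8 * Q := by linarith
  have hpG : p * G ≤ 8 * (Q : ℝ) ^ 2 := by nlinarith
  have hQ2 : (1000000 : ℝ) ≤ (Q : ℝ) ^ 2 := by nlinarith
  have hQ3 : (1000000000 : ℝ) ≤ (Q : ℝ) ^ 3 := by nlinarith
  -- Since `Q ≥ 1000`, anything of order `Q^{-2}` with constant up to 200 is below `1/(5Q)`.
  have hbig : ∀ (c : ℝ) (k : ℕ), 0 ≤ c → c ≤ 200 → 2 ≤ k → c / (Q : ℝ) ^ k ≤ (1 / 5) / Q := by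
    intro c k hc hc' hk
    have hQk : (Q : ℝ) ^ 2 ≤ (Q : ℝ) ^ k := pow_le_pow_right₀ (by linarith) hk
    rw [div_le_div_iff₀ (by positivity) hQ0]
    nlinarith
  push_cast at h1 h2
  have t1 : p * (1 + G) / (Q : ℝ) ^ 7 ≤ (1 / 5) / Q := by
    refine le_trans ?_ (hbig 9 5 (by norm_num) (by norm_num) (by norm_num))
    rw [div_le_div_iff₀ (by positivity) (by positivity)]
    have : p * (1 + G) ≤ 9 * (Q : ℝ) ^ 2 := by nlinarith
    calc _ ≤ 9 * (Q : ℝ) ^ 2 * (Q : ℝ) ^ 5 := by gcongr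
      _ = _ := by ring
  have t2 : 2 * p * G / (Q : ℝ) ^ 4 ≤ (1 / 5) / Q := by
    refine le_trans ?_ (hbig 16 2 (by norm_num) (by norm_num) (by norm_num))
    rw [div_le_div_iff₀ (by positivity) (by positivity)]
    have : 2 * p * G ≤ 16 * (Q : ℝ) ^ 2 := by linarith
    calc _ ≤ 16 * (Q : ℝ) ^ 2 * (Q : ℝ) ^ 2 := by gcongr
      _ = _ := by ring
  have t3 : p * (2 / (Q : ℝ) ^ 2) ≤ 2 / Q := by
    calc _ ≤ (Q : ℝ) * (2 / (Q : ℝ) ^ 2) := by gcongr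
      _ = _ := by field_simp
  have t4 : p * ((Q : ℝ) ^ 7 / (2 * (Q : ℝ) ^ 2 * (Q : ℝ) ^ 8)) ≤ (1 / 5) / Q := by
    refine le_trans ?_ (hbig (1 / 2) 2 (by norm_num) (by norm_num) (by norm_num))
    calc _ ≤ (Q : ℝ) * ((Q : ℝ) ^ 7 / (2 * (Q : ℝ) ^ 2 * (Q : ℝ) ^ 8)) := by gcongr
      _ = _ := by field_simp
  have t5 : p * (((Q : ℝ) ^ 2 * G + 2) ^ 2 / (2 * (Q : ℝ) ^ 2 * (Q : ℝ) ^ 7)) ≤ (1 / 5) / Q := by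
    refine le_trans ?_ (hbig (81 / 2) 2 (by norm_num) (by norm_num) (by norm_num))
    have : (Q : ℝ) ^ 2 * G + 2 ≤ 9 * (Q : ℝ) ^ 3 := by nlinarith
    calc _ ≤ (Q : ℝ) * ((9 * (Q : ℝ) ^ 3) ^ 2 / (2 * (Q : ℝ) ^ 2 * (Q : ℝ) ^ 7)) := by gcongr
      _ = _ := by field_simp; norm_num
  have t6 : p * (G / (Q : ℝ) ^ 7) ≤ (1 / 5) / Q := by
    refine le_trans ?_ (hbig 8 5 (by norm_num) (by norm_num) (by norm_num))
    rw [mul_div_assoc', div_le_div_iff₀ (by positivity) (by positivity)]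
    calc _ ≤ 8 * (Q : ℝ) ^ 2 * (Q : ℝ) ^ 5 := by gcongr
      _ = _ := by ring
  have hy9 : |y| ≤ 9 * (Q : ℝ) ^ 2 := by
    refine h2.trans ?_
    rw [mul_add]
    have : (2 : ℝ) / Q ≤ 1 := by rw [div_le_one hQ0]; linarith
    linarith
  have hM : |y| ≤ ((Q ^ 7 : ℕ) : ℝ) / 2 := by
    refine hy9.trans ?_
    push_cast
    have : (Q : ℝ) ^ 3 ≤ (Q : ℝ) ^ 7 := pow_le_pow_right₀ (by linarith) (by norm_num)
    nlinarith
  obtain ⟨hpow0, hpow⟩ := abs_log_one_sub_div_pow_sub_le (M := Q ^ 7) (by positivity) hM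
  push_cast at hpow0 hpow
  refine ⟨hpow0, ?_⟩
  have t7 : 2 * y ^ 2 / (Q : ℝ) ^ 7 ≤ (1 / 5) / Q := by
    refine le_trans ?_ (hbig 162 3 (by norm_num) (by norm_num) (by norm_num))
    have : y ^ 2 ≤ (9 * (Q : ℝ) ^ 2) ^ 2 := by
      rw [← sq_abs]
      gcongr
    rw [div_le_div_iff₀ (by positivity) (by positivity)]
    calc _ ≤ 2 * (9 * (Q : ℝ) ^ 2) ^ 2 * (Q : ℝ) ^ 3 := by gcongr
      _ = _ := by ring
  rw [Real.log_mul hv0.ne' (pow_pos hpow0 _).ne']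
  have e1 : (1 / 5 : ℝ) / Q = (1 / 5) * (1 / Q) := by ring
  have e2 : (2 : ℝ) / Q = 2 * (1 / Q) := by ring
  have e3 : (10 : ℝ) / Q = 10 * (1 / Q) := by ring
  have hinv : 0 < 1 / (Q : ℝ) := by positivity
  rw [e1] at t1 t2 t4 t5 t6 t7
  rw [e2] at t3
  rw [e3]
  have e4 := fun a b c d : ℝ => (by ring : p * (a + b + c + d) = p * a + p * b + p * c + p * d)
  rw [e4] at h1
  rw [abs_le] at h1 hpow hv ⊢
  -- The total is `1/Q` from `v`, twice `2/Q` from the oracle and six terms of `1/(5Q)`, which is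
  -- below `10/Q`.
  constructor <;> linarith

/-! ### The algorithm runs in polynomial time -/

/-- From the data `a i` and any admissible `n` and `D`, the array `g i n D` is computable in
polynomial time, also for families of several `n` and `D` for each `i`. -/
def OracleComputes {ι : Type} (m : ι → ℕ) (a : ι → Data) (p : ι → ℕ)
    (g : ι → (ℕ → ℤ) → ℕ → ℕ → ℤ) : Prop :=
  ∀ (κ : Type) (r : κ → ι) (b : κ → Data) (n : κ → ℕ → ℤ) (D : κ → ℕ),
    (∀ k, ∀ j < p (r k), 0 < n k j ∧ n k j < D k) →
    Computes (m ∘ r) b (a ∘ r) → Computes (m ∘ r) b (fun k => .num (D k)) →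
    Computes (m ∘ r) b (fun k => arr (fun j => .num (n k j)) (p (r k))) →
    Computes (m ∘ r) b (fun k => arr (fun j => .num (g (r k) (n k) (D k) j)) (p (r k)))

namespace Computes

variable {ι : Type} {m : ι → ℕ} {a : ι → Data} {p D T N : ι → ℕ}
  {g : ι → (ℕ → ℤ) → ℕ → ℕ → ℤ}

/-- The loop state stores the iterate and the running sum of each coordinate. The box constraint
bounds both, so their sizes do not depend on what the oracle returns. -/
theorem ascentSum (hp : PolyBounded m p) (hD : PolyBounded m D) (hT : PolyBounded m T)
    (hpc : Computes m a fun i => .num (p i)) (hDc : Computes m a fun i => .num (D i))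
    (hTc : Computes m a fun i => .num (T i)) (hD2 : ∀ i, 2 ≤ D i)
    (hO : OracleComputes m a p g) :
    Computes m a fun i => arr (fun j => .num (SuffStat.ascentSum (g i) (D i) (T i) j)) (p i) := by
  let st : ι → ℕ → Data := fun i t => arr (fun j =>
    .pair (.num (ascent (g i) (D i) t j)) (.num (SuffStat.ascentSum (g i) (D i) t j))) (p i)
  have hiter : Computes m a fun i => st i (T i) := by
    have one := const hpc.size_input 1
    have zero := const hpc.size_input 0
    refine iterate (st := st) hT hTc ?_ ?_
    · refine tabulate hp hpc (((one.underCounter hp).pair (zero.underCounter hp)).congr fun z => ?_)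
      simp [ascent, SuffStat.ascentSum]
    · have hsz : PolyBounded (m ∘ Below.idx (N := T)) fun z => (st z.idx z.pos).size := by
        refine ((hp.mul (((hD.add (hT.mul hD)).add (.const m 3)).add (.const m 1))).add
          (.const m 1)).reindex (Below.idx (N := T)) |>.mono fun z => size_arr_le fun j _ => ?_
        have h1 := one_le_ascent (g z.idx) (D z.idx) z.pos j
        have h2 := ascent_lt (g z.idx) (hD2 z.idx) z.pos j
        have h3 := le_ascentSum (g z.idx) (D z.idx) z.pos j
        have h4 := ascentSum_le (g z.idx) (hD2 z.idx) z.pos j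
        have h5 : (SuffStat.ascentSum (g z.idx) (D z.idx) z.pos j).natAbs ≤
            T z.idx * D z.idx := by
          have h6 : (z.pos : ℤ) * ((D z.idx : ℤ) - 1) ≤ T z.idx * D z.idx := by
            have hz : (z.pos : ℤ) ≤ T z.idx := by exact_mod_cast z.pos_lt.le
            have := hD2 z.idx
            exact mul_le_mul hz (by omega) (by omega) (by positivity)
          zify
          rw [abs_of_nonneg (by omega)]
          omega
        have h7 := natSize_le_self (ascent (g z.idx) (D z.idx) z.pos j).natAbs
        have h8 := natSize_le_self (SuffStat.ascentSum (g z.idx) (D z.idx) z.pos j).natAbs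
        simp only [Data.size]
        omega
      have hX := refl (polyBounded_size_pair (hpc.size_input.reindex (Below.idx (N := T)))
        (polyBounded_size_pair (polyBounded_size_num hT.pos) hsz))
      have hp' := hp.reindex (Below.idx (N := T))
      have hpc' := hX.fst.trans (hpc.reindex (Below.idx (N := T)))
      have hDc' := hX.fst.trans (hDc.reindex (Below.idx (N := T)))
      have hst := hX.snd.snd
      have hj := counter hX.size_input hp'
      have hget := get (N := fun z => p z.idx.idx) (fun z => z.pos_lt)
        (hp'.reindex Below.idx) (hst.underCounter hp') hj
      have hn := tabulate (x := fun z j => .num (ascent (g z.idx) (D z.idx) z.pos j)) hp' hpc'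
        hget.fst
      -- The oracle is called on the family of pairs of an instance and a round; this is why
      -- `OracleComputes` allows several queries per index.
      have hg := hO _ (Below.idx (N := T)) _ _ (fun z => D z.idx)
        (fun z j _ => ⟨one_le_ascent _ _ _ j, ascent_lt _ (hD2 _) _ j⟩) hX.fst hDc' hn
      have hgj := get (N := fun z => p z.idx.idx) (fun z => z.pos_lt)
        (hp'.reindex Below.idx) (hg.underCounter hp') hj
      have one' := const hgj.size_input 1
      refine tabulate hp' hpc' (((one'.max (((hDc'.underCounter hp').sub one').min
        (hget.fst.sub hgj))).pair (hget.snd.add hget.fst)).congr fun z => ?_)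
      simp [ascent, SuffStat.ascentSum, Finset.sum_range_succ]
  refine tabulate hp hpc ?_
  exact snd (get (N := fun z => p z.idx) (fun z => z.pos_lt) (hp.reindex Below.idx)
    (hiter.underCounter hp) (counter hpc.size_input hp))

theorem lineSum {S : ι → ℕ → ℤ} (hp : PolyBounded m p) (hN : PolyBounded m N)
    (hpc : Computes m a fun i => .num (p i)) (hDc : Computes m a fun i => .num (D i))
    (hTc : Computes m a fun i => .num (T i)) (hNc : Computes m a fun i => .num (N i))
    (hS : Computes m a fun i => arr (fun j => .num (S i j)) (p i))
    (hD2 : ∀ i, 2 ≤ D i) (hT0 : ∀ i, 0 < T i) (hN0 : ∀ i, 0 < N i)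
    (hS1 : ∀ i j, (T i : ℤ) ≤ S i j) (hS2 : ∀ i j, S i j ≤ T i * ((D i : ℤ) - 1))
    (hO : OracleComputes m a p g) :
    Computes m a fun i => .num (SuffStat.lineSum (p i) (g i) (T i) (N i) (D i) (S i)) := by
  have hNTD : Computes m a fun i => .num ((N i * T i * D i : ℕ) : ℤ) :=
    ((hNc.mul hTc).mul hDc).congr fun i => by push_cast; rfl
  refine sum (f := fun i k => ∑ j ∈ Finset.range (p i),
    g i (linePoint (T i) (N i) (S i) k) (N i * T i * D i) j * (S i j - T i)) hN hNc ?_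
  have hp' := hp.reindex (Below.idx (N := N))
  have hpc' := hpc.underCounter hN
  have hSc' := hS.underCounter hN
  have hTc' := hTc.underCounter hN
  have hk := counter hpc.size_input hN
  have hj := counter hpc'.size_input hp'
  have hSj := get (N := fun z => p z.idx.idx) (fun z => z.pos_lt)
    (hp'.reindex Below.idx) (hSc'.underCounter hp') hj
  have hpt := tabulate
    (x := fun (z : Below N) j => .num (linePoint (T z.idx) (N z.idx) (S z.idx) z.pos j)) hp' hpc'
    (((((hNc.underCounter hN).sub hk).mul hTc').underCounter hp').add
      ((hk.underCounter hp').mul hSj))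
  -- The points of the segment live on the finer grid of denominator `N T D`, and `linePoint_bounds`
  -- keeps them strictly inside the cube.
  have hg := hO _ (Below.idx (N := N)) _ _ (fun z => N z.idx * T z.idx * D z.idx)
    (fun z j _ => by
      have h1 := linePoint_bounds z.pos_lt.le (hS1 z.idx j) (hS2 z.idx j) (hD2 z.idx)
      have h2 : (0 : ℤ) < N z.idx * T z.idx := by
        have := hT0 z.idx
        have := hN0 z.idx
        positivity
      push_cast
      constructor
      · linarith [h1.1]
      · linarith [h1.2])
    (hpc.self.underCounter hN) (hNTD.underCounter hN) hpt
  have hgj := get (N := fun z => p z.idx.idx) (fun z => z.pos_lt)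
    (hp'.reindex Below.idx) (hg.underCounter hp') hj
  exact sum (f := fun z j => g z.idx (linePoint (T z.idx) (N z.idx) (S z.idx) z.pos)
    (N z.idx * T z.idx * D z.idx) j * (S z.idx j - T z.idx)) hp' hpc'
    (hgj.mul (hSj.sub (hTc'.underCounter hp')))

end Computes

/-! ### The parameter oracle given by an estimator -/

theorem size_le_size_arr {x : ℕ → Data} {n k : ℕ} (hk : k < n) :
    (x k).size ≤ (arr x n).size := by
  induction n generalizing x k with
  | zero => omega
  | succ n ih =>
    simp only [arr, Data.size]
    cases k with
    | zero => omega
    | succ k =>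
      have := ih (x := fun k => x (k + 1)) (k := k) (by omega)
      omega

theorem abs_ediv_div_sub_le (q : Frac) {W : ℕ} (hW : 0 < W) :
    |((q.num * W / q.den : ℤ) : ℝ) / W - q.val| ≤ 1 / W := by
  have hWr : (0 : ℝ) < W := by exact_mod_cast hW
  have hd : (0 : ℝ) < q.den := by exact_mod_cast q.den_pos
  have h1 : ((q.num * W / q.den : ℤ) : ℝ) * q.den ≤ q.num * W := by
    exact_mod_cast Int.ediv_mul_le (q.num * W) (by have := q.den_pos; omega)
  have h2 : (q.num : ℝ) * W < ((q.num * W / q.den : ℤ) + 1) * q.den := by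
    exact_mod_cast Int.lt_ediv_add_one_mul_self (q.num * W) (by have := q.den_pos; omega)
  have e : ((q.num * W / q.den : ℤ) : ℝ) / W - q.val =
      (((q.num * W / q.den : ℤ) : ℝ) * q.den - q.num * W) / (W * q.den) := by
    rw [Frac.val]
    field_simp
  rw [e, abs_div, abs_of_pos (mul_pos hWr hd), div_le_div_iff₀ (by positivity) hWr, abs_of_nonpos
    (by linarith)]
  nlinarith

/-- The estimator is called with `ξ = 1/W` and its output rounded down to multiples of `1/W`; the
two errors add up to `2/W`, and the slopes become integers over a fixed denominator. One `g` is
fixed before any index family, so accuracy and computability concern the same values. -/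
theorem exists_paramOracle {𝓗 : WeightFamily} (hest : HasPolynomialConsistentEstimator 𝓗) :
    ∃ g : (p : ℕ) → 𝓗.carrier p → ℕ → (ℕ → ℤ) → ℕ → ℕ → ℤ,
      (∀ p h W, 1 ≤ p → 0 < W → IsParamOracle h.1 W (g p h W)) ∧
      ∀ {ι : Type} (m : ι → ℕ) (a : ι → Data) (p : ι → ℕ) (h : ∀ i, 𝓗.carrier (p i))
        (W : ι → ℕ), (∀ i, 1 ≤ p i) → (∀ i, 0 < W i) →
        PolyBounded m (fun i => 𝓗.descLength (h i)) → PolyBounded m W →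
        Computes m a (fun i => 𝓗.toData (h i)) → Computes m a (fun i => .num (W i)) →
        OracleComputes m a p fun i => g (p i) (h i) (W i) := by
  classical
  obtain ⟨c, P, H⟩ := hest
  choose θhat hrun hθ using H
  have hτ : ∀ {p : ℕ} {n : ℕ → ℤ} {D : ℕ} (hD : 0 < D) (_ : ∀ j < p, 0 < n j ∧ n j < D)
      (i : Fin p), (Frac.mk (n i) D hD).val ∈ Set.Ioo (0 : ℝ) 1 := by
    intro p n D hD hn i
    have hDr : (0 : ℝ) < D := by exact_mod_cast hD
    have h1 : (0 : ℝ) < n i := by exact_mod_cast (hn i i.2).1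
    have h2 : (n i : ℝ) < D := by exact_mod_cast (hn i i.2).2
    exact ⟨div_pos h1 hDr, (div_lt_one hDr).2 h2⟩
  have hξ : ∀ {W : ℕ} (hW : 0 < W), 0 < (Frac.mk 1 W hW).val := fun {W} hW => by
    have : (0 : ℝ) < W := by exact_mod_cast hW
    simp only [Frac.val]
    positivity
  -- The estimator's answer depends on proofs that the query is admissible; the default `0` makes
  -- `q` total and is never met on admissible queries.
  let q : (p : ℕ) → 𝓗.carrier p → ℕ → (ℕ → ℤ) → ℕ → ℕ → Frac := fun p h W n D j =>
    if hc : 1 ≤ p ∧ 0 < W ∧ 0 < D ∧ (∀ j < p, 0 < n j ∧ n j < D) ∧ j < p then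
      θhat p h (fun i => ⟨n i, D, hc.2.2.1⟩) ⟨1, W, hc.2.1⟩ hc.1 (hτ hc.2.2.1 hc.2.2.2.1)
        (hξ hc.2.1) ⟨j, hc.2.2.2.2⟩
    else ⟨0, 1, one_pos⟩
  have hDpos : ∀ {p : ℕ} {n : ℕ → ℤ} {D : ℕ}, 1 ≤ p → (∀ j < p, 0 < n j ∧ n j < D) → 0 < D :=
    fun hp hn => by have := hn 0 hp; omega
  refine ⟨fun p h W n D j => (q p h W n D j).num * W / (q p h W n D j).den, ?_, ?_⟩
  · intro p h W hp hW n D hn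
    have hD := hDpos hp hn
    obtain ⟨θ, hm, hd⟩ := hθ p h (fun i => ⟨n i, D, hD⟩) ⟨1, W, hW⟩ hp (hτ hD hn) (hξ hW)
    refine ⟨θ, fun j => by rw [hm]; rfl, fun j => ?_⟩
    have h1 := abs_ediv_div_sub_le (q p h W n D j) hW
    have h2 : |(q p h W n D j).val - θ j| ≤ 1 / W := by
      have h3 := (PiLp.norm_apply_le (vecVal (θhat p h (fun i => ⟨n i, D, hD⟩) ⟨1, W, hW⟩ hp
        (hτ hD hn) (hξ hW)) - θ) j).trans hd
      have h4 : q p h W n D j = θhat p h (fun i => ⟨n i, D, hD⟩) ⟨1, W, hW⟩ hp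
        (hτ hD hn) (hξ hW) j := dif_pos ⟨hp, hW, hD, hn, j.2⟩
      rw [h4]
      simpa [vecVal, Frac.val, Real.norm_eq_abs] using h3
    have h5 := abs_sub_le (((q p h W n D j).num * W / (q p h W n D j).den : ℤ) / (W : ℝ))
      (q p h W n D j).val (θ j)
    have e : (2 : ℝ) / W = 1 / W + 1 / W := by ring
    rw [e]
    linarith
  · intro ι m a p h W hp hW hlen hWb hh hWc κ r b n D hn ha hDc hnc
    have hpb : PolyBounded m p := hlen.mono fun i => Nat.le_add_right _ _
    have hpb' := hpb.reindex r
    have hh' := ha.trans (hh.reindex r)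
    have hpc' := hh'.fst
    have hWc' := ha.trans (hWc.reindex r)
    have hD : ∀ k, 0 < D k := fun k => hDpos (hp _) (hn k)
    have hnj := Computes.get (N := fun z => p (r z.idx)) (fun z => z.pos_lt)
      (hpb'.reindex Below.idx) (hnc.underCounter hpb') (Computes.counter hnc.size_input hpb')
    have hτc := Computes.tabulate (x := fun k j => .pair (.num (n k j)) (.num (D k))) hpb' hpc'
      (hnj.pair (hDc.underCounter hpb'))
    have hin := hh'.pair (hτc.pair ((Computes.const hpc'.size_input 1).pair hWc'))
    have hout : Computes (m ∘ r) b fun k =>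
        arr (fun j => (q (p (r k)) (h (r k)) (W (r k)) (n k) (D k) j).toData) (p (r k)) := by
      refine hin.trans ⟨c, fun k => P.eval (⌈1 / (Frac.mk 1 (W (r k)) (hW (r k))).val⌉₊ + p (r k) +
        (Finset.univ.sup fun i : Fin (p (r k)) => (Frac.mk (n k i) (D k) (hD k)).length) +
        𝓗.descLength (h (r k)) + (Frac.mk 1 (W (r k)) (hW (r k))).length), ?_, fun k => ?_⟩
      · refine PolyBounded.eval P ((((((hWb.reindex r).mono fun k => ?_).add hpb').add
          (hτc.size_output.mono fun k => ?_)).add (hlen.reindex r)).add ?_)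
        · simp [Frac.val]
        · refine Finset.sup_le fun i _ => ?_
          exact size_le_size_arr (x := fun j => .pair (.num (n k j)) (.num (D k))) i.2
        · exact ((Computes.const hpc'.size_input 1).pair hWc').size_output
      · have h1 := hrun (p (r k)) (h (r k)) (fun i => ⟨n k i, D k, hD k⟩)
          ⟨1, W (r k), hW (r k)⟩ (hp _) (hτ (hD k) (hn k)) (hξ (hW _))
        have e1 : vecToData (fun i : Fin (p (r k)) => (⟨n k i, D k, hD k⟩ : Frac)) =
            arr (fun j => .pair (.num (n k j)) (.num (D k))) (p (r k)) := by
          rw [vecToData, arr_ofFn]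
          exact arr_congr fun j hj => by rw [dif_pos hj]; rfl
        have e2 : vecToData (θhat (p (r k)) (h (r k)) (fun i => ⟨n k i, D k, hD k⟩)
            ⟨1, W (r k), hW (r k)⟩ (hp _) (hτ (hD k) (hn k)) (hξ (hW _))) =
            arr (fun j => (q (p (r k)) (h (r k)) (W (r k)) (n k) (D k) j).toData) (p (r k)) := by
          rw [vecToData, arr_ofFn]
          refine arr_congr fun j hj => ?_
          simp only [q]
          rw [dif_pos hj, dif_pos ⟨hp _, hW _, hD k, hn k, hj⟩]
        rw [e1, e2] at h1
        exact h1
    have hqj := Computes.get (N := fun z => p (r z.idx)) (fun z => z.pos_lt)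
      (hpb'.reindex Below.idx) (hout.underCounter hpb') (Computes.counter hnc.size_input hpb')
    exact Computes.tabulate hpb' hpc' ((hqj.fst.mul (hWc'.underCounter hpb')).div hqj.snd)

/-! ### Approximation of the partition function -/

/-- The real coefficients of `K` are not available to a program, but the integers `C` and `d` can be
built into one. -/
theorem exists_nat_mul_pow_bound (K : Polynomial ℝ) :
    ∃ C d : ℕ, 1 ≤ C ∧ ∀ p : ℕ, 1 ≤ p → K.eval (p : ℝ) ≤ (C * p ^ d : ℕ) := by
  refine ⟨⌈∑ i ∈ Finset.range (K.natDegree + 1), |K.coeff i|⌉₊ + 1, K.natDegree, by omega,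
    fun p hp => ?_⟩
  have hp' : (1 : ℝ) ≤ p := by exact_mod_cast hp
  rw [Polynomial.eval_eq_sum_range]
  calc _ ≤ ∑ i ∈ Finset.range (K.natDegree + 1), |K.coeff i| * (p : ℝ) ^ K.natDegree := by
        refine Finset.sum_le_sum fun i hi => ?_
        have hi' : i ≤ K.natDegree := Nat.lt_succ_iff.1 (Finset.mem_range.1 hi)
        exact mul_le_mul (le_abs_self _) (pow_le_pow_right₀ hp' hi') (by positivity)
          (abs_nonneg _)
    _ ≤ _ := by
        rw [← Finset.sum_mul]
        push_cast
        gcongr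
        exact (Nat.le_ceil _).trans (by linarith)

theorem size_ofBits_le (s : List Bool) : (Data.ofBits s).size ≤ 3 * s.length + 1 := by
  induction s with
  | nil => simp [Data.ofBits, Data.ofList, Data.size]
  | cons b s ih =>
    have hb : (Data.num (if b then 1 else 0)).size ≤ 2 := by cases b <;> simp [Data.size]
    simp only [Data.ofBits, List.map_cons, Data.ofList, List.length_cons] at ih ⊢
    rw [Data.size]
    omega

theorem size_toData_le (𝓗 : WeightFamily) {p : ℕ} (h : 𝓗.carrier p) :
    (𝓗.toData h).size ≤ 3 * 𝓗.descLength h + 3 := by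
  have h1 := size_ofBits_le (𝓗.code p h)
  have h2 := natSize_le_self p
  simp only [WeightFamily.toData, WeightFamily.descLength, Data.size, Int.natAbs_natCast]
  omega

theorem Frac.num_pos_of_val_pos {q : Frac} (hq : 0 < q.val) : 0 < q.num := by
  have hd : (0 : ℝ) < q.den := by exact_mod_cast q.den_pos
  have : (0 : ℝ) < q.num := by
    rw [Frac.val] at hq
    exact (div_pos_iff_of_pos_right hd).1 hq
  exact_mod_cast this

/-- Under a polynomial bound on the oscillation of `log h`, an estimator yields an approximation
scheme for the partition function. -/
theorem exists_partitionFn_approximation {𝓗 : WeightFamily} {K : Polynomial ℝ}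
    (hC3 : ConditionC3 𝓗 K) (heval : EvaluableAtZero 𝓗)
    (hest : HasPolynomialConsistentEstimator 𝓗) :
    ∃ (c : Prog) (P : Polynomial ℕ), ∀ (p : ℕ) (h : 𝓗.carrier p) (ε : Frac), 1 ≤ p →
      0 < ε.val →
      ∃ Zhat : Frac,
        RunsWithin c (.pair (𝓗.toData h) ε.toData) Zhat.toData
          (P.eval (𝓗.descLength h + ε.length + ⌈1 / ε.val⌉₊)) ∧
        Real.exp (-ε.val) * partitionFn h.1 0 ≤ Zhat.val ∧
        Zhat.val ≤ Real.exp ε.val * partitionFn h.1 0 := by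
  obtain ⟨C, d, hC, hKC⟩ := exists_nat_mul_pow_bound K
  obtain ⟨g, hgspec, hgcomp⟩ := exists_paramOracle hest
  obtain ⟨c₀, P₀, H₀⟩ := heval
  -- All admissible instances form one index set, so that `Computes` over it means a single program
  -- with a uniform time bound.
  let ι : Type := {x : (Σ p, 𝓗.carrier p) × Frac // 1 ≤ x.1.1 ∧ 0 < x.2.val}
  let p : ι → ℕ := fun i => i.1.1.1
  let h : (i : ι) → 𝓗.carrier (p i) := fun i => i.1.1.2
  let ε : ι → Frac := fun i => i.1.2
  have hp : ∀ i, 1 ≤ p i := fun i => i.2.1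
  have hε : ∀ i, 0 < (ε i).val := fun i => i.2.2
  have hεnum : ∀ i, 0 < (ε i).num := fun i => Frac.num_pos_of_val_pos (hε i)
  let m : ι → ℕ := fun i => 𝓗.descLength (h i) + (ε i).length + ⌈1 / (ε i).val⌉₊
  let a : ι → Data := fun i => .pair (𝓗.toData (h i)) (ε i).toData
  let E : ι → ℕ := fun i => (((ε i).den : ℤ) / (ε i).num).toNat + 1
  -- `E` is an integer above `1/ε`, so the factor `1000 E` gives `10/Q ≤ ε`. The factor `C p^(d+1)`
  -- dominates both `K(p)` and `p`; the extra power of `p` covers `d = 0`.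
  let Q : ι → ℕ := fun i => 1000 * C * p i ^ (d + 1) * E i
  have hm := PolyBounded.self m
  have hlen : PolyBounded m fun i => 𝓗.descLength (h i) :=
    hm.mono fun i => by simp only [m]; omega
  have hpb : PolyBounded m p := hlen.mono fun i => Nat.le_add_right _ _
  have hεinv : ∀ i, 1 / (ε i).val = ((ε i).den : ℝ) / (ε i).num := fun i => by
    rw [Frac.val, one_div_div]
  have hEle : ∀ i, E i ≤ ⌈1 / (ε i).val⌉₊ + 1 := fun i => by
    have hn : (0 : ℝ) < (ε i).num := by exact_mod_cast hεnum i
    have h1 : ((((ε i).den : ℤ) / (ε i).num : ℤ) : ℝ) ≤ 1 / (ε i).val := by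
      rw [hεinv, le_div_iff₀ hn]
      exact_mod_cast Int.ediv_mul_le ((ε i).den : ℤ) (hεnum i).ne'
    have h2 : (((ε i).den : ℤ) / (ε i).num : ℤ) ≤ (⌈1 / (ε i).val⌉₊ : ℤ) := by
      exact_mod_cast h1.trans (Nat.le_ceil _)
    simp only [E]
    omega
  have hEge : ∀ i, 1 / (E i : ℝ) ≤ (ε i).val := fun i => by
    have hn : (0 : ℝ) < (ε i).num := by exact_mod_cast hεnum i
    have hE0 : (0 : ℝ) < E i := by simp only [E]; positivity
    have h0 : 0 ≤ ((ε i).den : ℤ) / (ε i).num :=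
      Int.ediv_nonneg (by positivity) (hεnum i).le
    have h1 : ((ε i).den : ℝ) < ((((ε i).den : ℤ) / (ε i).num : ℤ) + 1) * (ε i).num := by
      exact_mod_cast Int.lt_ediv_add_one_mul_self ((ε i).den : ℤ) (hεnum i)
    have h2 : (E i : ℝ) = (((ε i).den : ℤ) / (ε i).num : ℤ) + 1 := by
      have : (E i : ℤ) = ((ε i).den : ℤ) / (ε i).num + 1 := by
        simp only [E]
        push_cast
        rw [Int.toNat_of_nonneg h0]
      exact_mod_cast this
    rw [← h2] at h1
    rw [one_div_le hE0 (hε i), hεinv, div_le_iff₀ hn]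
    exact h1.le
  have hEb : PolyBounded m E :=
    (hm.add (.const m 1)).mono fun i => (hEle i).trans (by simp only [m]; omega)
  have hQb : PolyBounded m Q := ((PolyBounded.const m (1000 * C)).mul (hpb.pow (d + 1))).mul hEb
  have hE1 : ∀ i, 1 ≤ E i := fun i => by simp only [E]; omega
  have hQE : ∀ i, 1000 * E i ≤ Q i := fun i => by
    have : 1 ≤ C * p i ^ (d + 1) := Nat.one_le_iff_ne_zero.2
      (Nat.mul_ne_zero (by omega) (pow_ne_zero _ (by have := hp i; omega)))
    calc 1000 * E i = 1000 * 1 * E i := by ring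
      _ ≤ 1000 * (C * p i ^ (d + 1)) * E i := by gcongr
      _ = Q i := by simp only [Q]; ring
  have hQ : ∀ i, 1000 ≤ Q i := fun i => le_trans (by have := hE1 i; omega) (hQE i)
  have hQ0 : ∀ i, 0 < Q i := fun i => by have := hQ i; omega
  have hQC : ∀ i, C * p i ^ (d + 1) ≤ Q i := fun i => by
    calc C * p i ^ (d + 1) = 1 * (C * p i ^ (d + 1)) * 1 := by ring
      _ ≤ 1000 * (C * p i ^ (d + 1)) * E i := by
        gcongr
        · norm_num
        · exact hE1 i
      _ = Q i := by simp only [Q]; ring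
  have hpQ : ∀ i, p i ≤ Q i := fun i =>
    ((Nat.le_self_pow (by omega) _).trans (Nat.le_mul_of_pos_left _ hC)).trans (hQC i)
  have hKQ : ∀ i, K.eval (p i : ℝ) ≤ Q i := fun i => by
    refine (hKC (p i) (hp i)).trans ?_
    have : C * p i ^ d ≤ C * p i ^ (d + 1) :=
      Nat.mul_le_mul_left _ (Nat.pow_le_pow_right (hp i) (by omega))
    exact_mod_cast this.trans (hQC i)
  have hain : Computes m a a := Computes.refl <| by
    refine (((PolyBounded.const m 4).mul hm).add (.const m 4)).mono fun i => ?_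
    have := size_toData_le 𝓗 (h i)
    simp only [a, m, Data.size, Frac.length]
    omega
  have hhc : Computes m a fun i => 𝓗.toData (h i) := hain.fst
  have hpc : Computes m a fun i => .num (p i) := hhc.fst
  have hεc : Computes m a fun i => (ε i).toData := hain.snd
  have hEc : Computes m a fun i => .num (E i) :=
    ((hεc.snd.div hεc.fst).add (Computes.const hain.size_input 1)).congr fun i => by
      have h0 : 0 ≤ ((ε i).den : ℤ) / (ε i).num :=
        Int.ediv_nonneg (by positivity) (hεnum i).le
      simp only [E]
      push_cast
      rw [Int.toNat_of_nonneg h0]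
  have hQc : Computes m a fun i => .num (Q i) :=
    (((Computes.const hain.size_input (1000 * C : ℤ)).mul (hpc.powConst (d + 1))).mul hEc).congr
      fun i => by simp [Q]
  have hQpow : ∀ k : ℕ, Computes m a fun i => .num ((Q i ^ k : ℕ) : ℤ) := fun k =>
    (hQc.powConst k).congr fun i => by push_cast; rfl
  choose v hvrun hv1 hv2 using fun i : ι =>
    H₀ (p i) (h i) ⟨1, Q i, hQ0 i⟩ (hp i) (by
      have : (0 : ℝ) < Q i := by exact_mod_cast hQ0 i
      simp only [Frac.val]
      positivity)
  have hvc : Computes m a fun i => (v i).toData := by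
    have hηc := (Computes.const hain.size_input 1).pair hQc
    refine (hhc.pair hηc).trans ⟨c₀, _, PolyBounded.eval P₀ ((hlen.add hηc.size_output).add
      (hQb.mono fun i => ?_)), hvrun⟩
    simp [Frac.val]
  let γ : ι → (ℕ → ℤ) → ℕ → ℕ → ℤ := fun i => g (p i) (h i) (Q i ^ 2)
  have hO : OracleComputes m a p γ := hgcomp m a p h (fun i => Q i ^ 2) hp
    (fun i => pow_pos (hQ0 i) 2) hlen (hQb.pow 2) hhc (hQpow 2)
  have hD2 : ∀ i, 2 ≤ Q i ^ 7 := fun i =>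
    le_trans (by have := hQ i; omega) (Nat.le_self_pow (by norm_num) (Q i))
  let S : ι → ℕ → ℤ := fun i => ascentSum (γ i) (Q i ^ 7) (Q i ^ 8)
  have hSc : Computes m a fun i => arr (fun j => .num (S i j)) (p i) :=
    Computes.ascentSum hpb (hQb.pow 7) (hQb.pow 8) hpc (hQpow 7) (hQpow 8) hD2 hO
  let R : ι → ℤ := fun i => lineSum (p i) (γ i) (Q i ^ 8) (Q i ^ 4) (Q i ^ 7) (S i)
  have hRc : Computes m a fun i => .num (R i) :=
    Computes.lineSum hpb (hQb.pow 4) hpc (hQpow 7) (hQpow 8) (hQpow 4) hSc hD2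
      (fun i => pow_pos (hQ0 i) 8) (fun i => pow_pos (hQ0 i) 4) (fun i j => le_ascentSum _ _ _ j)
      (fun i j => ascentSum_le _ (hD2 i) _ j) hO
  -- The denominator `W N T D` of the Riemann sum, so that `y = R / B`.
  let B : ι → ℕ := fun i => Q i ^ 2 * (Q i ^ 4 * Q i ^ 8 * Q i ^ 7)
  have hBc : Computes m a fun i => .num (B i * (Q i ^ 7 : ℕ) : ℤ) :=
    (((hQpow 2).mul (((hQpow 4).mul (hQpow 8)).mul (hQpow 7))).mul (hQpow 7)).congr
      fun i => by simp [B]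
  -- This is `v (1 - y/M)^M` with `M = Q^7`, over a common denominator.
  let Zhat : ι → Frac := fun i =>
    ⟨(v i).num * (B i * (Q i ^ 7 : ℕ) - R i) ^ Q i ^ 7,
      (v i).den * (B i * Q i ^ 7) ^ Q i ^ 7,
      Nat.mul_pos (v i).den_pos (pow_pos (Nat.mul_pos
        (by have := hQ0 i; simp only [B]; positivity) (pow_pos (hQ0 i) 7)) _)⟩
  have hZc : Computes m a fun i => (Zhat i).toData :=
    ((hvc.fst.mul (Computes.pow (hQb.pow 7) (hQpow 7) (hBc.sub hRc))).pair
      (hvc.snd.mul (Computes.pow (hQb.pow 7) (hQpow 7) hBc))).congr fun i => by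
        simp [Zhat, Frac.toData]
  have hZ : ∀ i, Real.exp (-(ε i).val) * partitionFn (h i).1 0 ≤ (Zhat i).val ∧
      (Zhat i).val ≤ Real.exp (ε i).val * partitionFn (h i).1 0 := by
    intro i
    have hQr : (0 : ℝ) < Q i := by exact_mod_cast hQ0 i
    have hpos := 𝓗.pos (p i) (h i).1 (h i).2
    have hη : (Frac.mk 1 (Q i) (hQ0 i)).val = 1 / Q i := by simp [Frac.val]
    have hv0 : 0 < (v i).val := (mul_pos (Real.exp_pos _) (hpos _)).trans_le (hv1 i)
    have hvlog : |Real.log (v i).val - Real.log ((h i).1 fun _ => false)| ≤ 1 / Q i := by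
      have h1 := Real.log_le_log (mul_pos (Real.exp_pos _) (hpos _)) (hv1 i)
      have h2 := Real.log_le_log hv0 (hv2 i)
      rw [Real.log_mul (Real.exp_pos _).ne' (hpos _).ne', Real.log_exp, hη] at h1 h2
      rw [abs_le]
      constructor <;> linarith
    obtain ⟨hbase, hest⟩ := abs_log_estimate_sub_le hpos (hC3 (p i) (hp i) (h i).1 (h i).2)
      (hpQ i) (hKQ i) (hQ i) (hgspec (p i) (h i) (Q i ^ 2) (hp i) (pow_pos (hQ0 i) 2))
      (y := (R i : ℝ) / (Q i ^ 2 * (Q i ^ 4 * Q i ^ 8 * Q i ^ 7))) rfl hvlog hv0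
    have hval : (Zhat i).val = (v i).val * (1 - (R i : ℝ) /
        (Q i ^ 2 * (Q i ^ 4 * Q i ^ 8 * Q i ^ 7)) / Q i ^ 7) ^ Q i ^ 7 := by
      have e : 1 - (R i : ℝ) / (Q i ^ 2 * (Q i ^ 4 * Q i ^ 8 * Q i ^ 7)) / Q i ^ 7 =
          ((B i : ℝ) * (Q i ^ 7 : ℕ) - R i) / (B i * (Q i ^ 7 : ℕ)) := by
        simp only [B]
        push_cast
        field_simp
      rw [e, div_pow]
      simp only [Zhat, Frac.val]
      push_cast
      rw [mul_div_mul_comm]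
    have hZ0 : 0 < (Zhat i).val := by
      rw [hval]
      exact mul_pos hv0 (pow_pos hbase _)
    have hpart := partitionFn_pos hpos 0
    rw [← hval] at hest
    have hsmall : (10 : ℝ) / Q i ≤ (ε i).val := by
      refine le_trans ?_ (hEge i)
      have h1 : (1000 : ℝ) * E i ≤ Q i := by exact_mod_cast hQE i
      have h2 : (1 : ℝ) ≤ E i := by exact_mod_cast hE1 i
      rw [div_le_div_iff₀ hQr (by linarith)]
      linarith
    rw [abs_le] at hest
    constructor
    · rw [← Real.log_le_log_iff (mul_pos (Real.exp_pos _) hpart) hZ0,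
        Real.log_mul (Real.exp_pos _).ne' hpart.ne', Real.log_exp]
      linarith
    · rw [← Real.log_le_log_iff hZ0 (mul_pos (Real.exp_pos _) hpart),
        Real.log_mul (Real.exp_pos _).ne' hpart.ne', Real.log_exp]
      linarith
  obtain ⟨c, T, ⟨P, hP⟩, hrun⟩ := hZc
  refine ⟨c, P, fun p' h' ε' hp' hε' => ?_⟩
  let i : ι := ⟨(⟨p', h'⟩, ε'), hp', hε'⟩
  obtain ⟨t, ht, hr⟩ := hrun i
  exact ⟨Zhat i, ⟨t, ht.trans (hP i), hr⟩, hZ i⟩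

end SuffStat

/- The marginal and covariance conditions are not needed: the dual is maximized by projected
subgradient steps, whose analysis only uses the oscillation bound on `log h`. -/
open SuffStat in
theorem mainTheorem1 (𝓗 : WeightFamily) (δ : ℕ → ℝ) (L K : Polynomial ℝ)
    (hδ : ∀ p, 1 ≤ p → δ p ∈ Set.Ioo (0 : ℝ) (1 / 2))
    (hC1 : ConditionC1 𝓗 δ) (hC2 : ConditionC2 𝓗 δ L) (hC3 : ConditionC3 𝓗 K)
    (heval : EvaluableAtZero 𝓗) (hest : HasPolynomialConsistentEstimator 𝓗) :
    ∃ (c : Prog) (P : Polynomial ℕ), ∀ (p : ℕ) (h : 𝓗.carrier p) (ε : Frac), 1 ≤ p →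
      4 * p * δ p * (K.eval (p : ℝ) + Real.log (4 / δ p)) < ε.val →
      ∃ Zhat : Frac,
        RunsWithin c (.pair (𝓗.toData h) ε.toData) Zhat.toData
          (P.eval (𝓗.descLength h + ε.length + ⌈1 / ε.val⌉₊)) ∧
        Real.exp (-ε.val) * partitionFn h.1 0 ≤ Zhat.val ∧
        Zhat.val ≤ Real.exp ε.val * partitionFn h.1 0 := by
  obtain ⟨c, P, H⟩ := exists_partitionFn_approximation hC3 heval hest
  -- The threshold for `ε` is nonnegative, as `K(p) ≥ 0` and `4/δ_p ≥ 1`; hence `ε > 0`.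
  refine ⟨c, P, fun p h ε hp hε => H p h ε hp (lt_of_le_of_lt ?_ hε)⟩
  obtain ⟨hδ0, hδ1⟩ := hδ p hp
  have hK0 : 0 ≤ K.eval (p : ℝ) :=
    (abs_nonneg _).trans (hC3 p hp h.1 h.2 (fun _ => false) fun _ => false)
  have hlog : 0 ≤ Real.log (4 / δ p) :=
    Real.log_nonneg (by rw [le_div_iff₀ hδ0]; linarith)
  positivity
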